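/- For a finite set $S\subset\mathbb{R}^2$ let $M_i(S)$ ($i=1,2,3,4$) be the union, over $s\in S$, of the closed $i$-th axis-parallel quadrants with apex $s$ (upper right, upper left, lower left, lower right), and let $RCH(S)=\bigcap_{i=1}^{4}M_i(S)$ be the rectilinear convex hull of $S$. Theorem (MaxEmptyRCH). There is an algorithm with the following property. Given a set $P$ of $n$ points in the plane (in arbitrary order), no two of which share an $x$-coordinate or a $y$-coordinate, it finds, in $O(n^3)$ time and $O(n^2)$ space, a subset $S\subseteq P$ such that no point of $P$ lies in the interior of $RCH(S)$ and such that the number of points of $P$ on the boundary of $RCH(S)$ is maximum among all subsets $S'\subseteq P$ for which no point of $P$ lies in the interior of $RCH(S')$. Here the algorithm is one fixed program for a random access machine with unit-cost operations. The points are a read-only input whose real coordinates are accessed only by comparing the $x$-coordinates, or the $y$-coordinates, of two points. The working memory has $O(n^2)$ cells, each holding a natural number of $O(\log n)$ bits, with addition, truncated subtraction, multiplication, integer division, comparison and indirect addressing. For $n\le 1$ the bounds are read as $O(1)$. -/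

import Mathlib

namespace RectHull

/-! ### Rectilinear convex hulls in the plane -/

/-- The open axis-parallel quadrants with apex `p`, in counter-clockwise order: the indices
`0, 1, 2, 3` stand for the first (upper right), second (upper left), third (lower left) and
fourth (lower right) quadrant. -/
def quadrant : Fin 4 → ℝ × ℝ → Set (ℝ × ℝ)
  | 0, p => Set.Ioi p.1 ×ˢ Set.Ioi p.2
  | 1, p => Set.Iio p.1 ×ˢ Set.Ioi p.2
  | 2, p => Set.Iio p.1 ×ˢ Set.Iio p.2
  | 3, p => Set.Ioi p.1 ×ˢ Set.Iio p.2

/-- The union of the closed `i`-th quadrants of the points of `S`. -/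
def quadrantUnion (i : Fin 4) (S : Set (ℝ × ℝ)) : Set (ℝ × ℝ) :=
  ⋃ p ∈ S, closure (quadrant i p)

/-- The rectilinear convex hull of `S`. -/
def rch (S : Set (ℝ × ℝ)) : Set (ℝ × ℝ) :=
  ⋂ i : Fin 4, quadrantUnion i S

/-- No point of `P` lies in the interior of the rectilinear convex hull of `S`. -/
def IsEmptyRCH (P S : Set (ℝ × ℝ)) : Prop :=
  P ∩ interior (rch S) = ∅

/-- The number of points of `P` on the boundary of the rectilinear convex hull of `S`. -/
noncomputable def rchSize (P S : Set (ℝ × ℝ)) : ℕ :=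
  (P ∩ frontier (rch S)).ncard

/-- `S` is a solution of the problem MaxEmptyRCH for the point set `P`. -/
def IsMaxEmptyRCH (P S : Set (ℝ × ℝ)) : Prop :=
  S ⊆ P ∧ IsEmptyRCH P S ∧ ∀ S' ⊆ P, IsEmptyRCH P S' → rchSize P S' ≤ rchSize P S

/-- General position: no two points share an `x`-coordinate or a `y`-coordinate. -/
def GeneralPosition {n : ℕ} (p : Fin n → ℝ × ℝ) : Prop :=
  Function.Injective (fun i => (p i).1) ∧ Function.Injective (fun i => (p i).2)

/-! ### Random access machines

The machine has a read-only input, the points `p 0, …, p (n - 1)`, whose real coordinates it can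
only compare, and a read-write memory of `M` cells, each of which holds a word, that is, a natural
number below `M`. Words are also the addresses of the cells. A program that computes a word
`≥ M`, or compares points with an index `≥ n`, is stuck and has no execution. Such a program is
in particular a program of a real RAM; it uses no real arithmetic and no large integers. -/

/-- Word-valued expressions: constants, the content of the cell at a computed address,
and arithmetic (truncated subtraction, integer division). -/
inductive Expr : Type
  | lit (k : ℕ)
  | load (a : Expr)
  | add (a b : Expr)
  | sub (a b : Expr)
  | mul (a b : Expr)
  | div (a b : Expr)

/-- Tests: comparison of words, comparison of the `x`-coordinates or of the `y`-coordinates of the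
two input points with given indices, and Boolean combinations. -/
inductive Test : Type
  | eq (a b : Expr)
  | lt (a b : Expr)
  | xlt (a b : Expr)
  | ylt (a b : Expr)
  | not (s : Test)
  | and (s t : Test)

/-- Programs. `store a e` writes the value of `e` into the cell whose address is the value
of `a`. -/
inductive Prog : Type
  | skip
  | store (a e : Expr)
  | seq (c d : Prog)
  | ite (s : Test) (c d : Prog)
  | while (s : Test) (c : Prog)

/-- The word `v`, if it fits into a cell. -/
def word (M v : ℕ) : Option ℕ := if v < M then some v else none

/-- The value of an expression; `none` if a word bound is violated. -/
def Expr.eval (M : ℕ) (mem : ℕ → ℕ) : Expr → Option ℕ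
  | .lit k => word M k
  | .load a => (a.eval M mem).map mem
  | .add a b => (a.eval M mem).bind fun i => (b.eval M mem).bind fun j => word M (i + j)
  | .sub a b => (a.eval M mem).bind fun i => (b.eval M mem).bind fun j => word M (i - j)
  | .mul a b => (a.eval M mem).bind fun i => (b.eval M mem).bind fun j => word M (i * j)
  | .div a b => (a.eval M mem).bind fun i => (b.eval M mem).bind fun j => word M (i / j)

/-- The number of steps for evaluating an expression: one for each operation in it. -/
def Expr.cost : Expr → ℕ
  | .lit _ => 1
  | .load a => a.cost + 1
  | .add a b => a.cost + b.cost + 1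
  | .sub a b => a.cost + b.cost + 1
  | .mul a b => a.cost + b.cost + 1
  | .div a b => a.cost + b.cost + 1

open Classical in
/-- The truth value of a test; `none` if a word bound or the input range is violated. -/
noncomputable def Test.eval {n : ℕ} (p : Fin n → ℝ × ℝ) (M : ℕ) (mem : ℕ → ℕ) :
    Test → Option Bool
  | .eq a b => (a.eval M mem).bind fun i => (b.eval M mem).bind fun j => some (decide (i = j))
  | .lt a b => (a.eval M mem).bind fun i => (b.eval M mem).bind fun j => some (decide (i < j))
  | .xlt a b => (a.eval M mem).bind fun i => (b.eval M mem).bind fun j =>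
      if h : i < n ∧ j < n then some (decide ((p ⟨i, h.1⟩).1 < (p ⟨j, h.2⟩).1)) else none
  | .ylt a b => (a.eval M mem).bind fun i => (b.eval M mem).bind fun j =>
      if h : i < n ∧ j < n then some (decide ((p ⟨i, h.1⟩).2 < (p ⟨j, h.2⟩).2)) else none
  | .not s => (s.eval p M mem).map fun x => !x
  | .and s t => (s.eval p M mem).bind fun x => (t.eval p M mem).map fun y => x && y

/-- The number of steps for evaluating a test. -/
def Test.cost : Test → ℕ
  | .eq a b => a.cost + b.cost + 1
  | .lt a b => a.cost + b.cost + 1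
  | .xlt a b => a.cost + b.cost + 1
  | .ylt a b => a.cost + b.cost + 1
  | .not s => s.cost + 1
  | .and s t => s.cost + t.cost + 1

/-- `Exec p M c mem t mem'`: on the input `p`, in a memory of `M` cells with content `mem`, the
program `c` terminates after exactly `t` steps and leaves the memory content `mem'`. -/
inductive Exec {n : ℕ} (p : Fin n → ℝ × ℝ) (M : ℕ) :
    Prog → (ℕ → ℕ) → ℕ → (ℕ → ℕ) → Prop
  | skip (mem : ℕ → ℕ) : Exec p M .skip mem 1 mem
  | store {a e : Expr} {mem : ℕ → ℕ} {i v : ℕ}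
      (ha : a.eval M mem = some i) (he : e.eval M mem = some v) :
      Exec p M (.store a e) mem (a.cost + e.cost + 1) (Function.update mem i v)
  | seq {c d : Prog} {mem mem' mem'' : ℕ → ℕ} {t t' : ℕ}
      (hc : Exec p M c mem t mem') (hd : Exec p M d mem' t' mem'') :
      Exec p M (.seq c d) mem (t + t') mem''
  | ite_true {s : Test} {c d : Prog} {mem mem' : ℕ → ℕ} {t : ℕ}
      (hs : s.eval p M mem = some true) (hc : Exec p M c mem t mem') :
      Exec p M (.ite s c d) mem (s.cost + 1 + t) mem'
  | ite_false {s : Test} {c d : Prog} {mem mem' : ℕ → ℕ} {t : ℕ}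
      (hs : s.eval p M mem = some false) (hd : Exec p M d mem t mem') :
      Exec p M (.ite s c d) mem (s.cost + 1 + t) mem'
  | while_false {s : Test} {c : Prog} {mem : ℕ → ℕ}
      (hs : s.eval p M mem = some false) :
      Exec p M (.while s c) mem (s.cost + 1) mem
  | while_true {s : Test} {c : Prog} {mem mem' mem'' : ℕ → ℕ} {t t' : ℕ}
      (hs : s.eval p M mem = some true) (hc : Exec p M c mem t mem')
      (hw : Exec p M (.while s c) mem' t' mem'') :
      Exec p M (.while s c) mem (s.cost + 1 + t + t') mem''

/-- The initial memory: cell `0` holds the number `n` of points, all other cells hold `0`. -/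
def initMem (n : ℕ) : ℕ → ℕ := fun a => if a = 0 then n else 0

/-- The subset of the input points that a final memory describes: the point with index `i`
belongs to it if and only if the cell `i` holds a nonzero word. -/
def outputSet {n : ℕ} (p : Fin n → ℝ × ℝ) (mem : ℕ → ℕ) : Set (ℝ × ℝ) :=
  {z | ∃ i : Fin n, mem i ≠ 0 ∧ p i = z}

end RectHull

namespace RectHull

/-! ### The sweep recursion -/

/-! A point is interior to the hull of S exactly when each of its four open quadrants contains a
point of S (`mem_interior_rch_iff`). If this happens for no point of P, then general position forces
every point of P in the hull to belong to S, and all of S lies on the boundary. So the quantity to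
maximise is |S|, and only the two coordinate orders matter: a point becomes a pair of ranks (s, Y
s), and the condition on the selected set becomes `Unsurrounded`.

Select the points from left to right and remember only a lower point `lo`, an upper point `hi` and
two flags. While `a` is false, `hi` is the highest selected point; once `a` is true, it is a ceiling
for all later selections. The pair `b`, `lo` behaves symmetrically. A next point e below `lo` always
has an empty quadrant: the lower left one if `b` is false, the lower right one if `b` is true. It
may be skipped, or taken when `b` is false, with a free choice of the new flag. Points above `hi`
are symmetric. A point strictly between `lo` and `hi` has both left quadrants occupied, so all later
selections must lie below it or all above it. In the first case the ceiling must already be in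
force, and taking e as the new ceiling costs nothing; the second case is symmetric. If neither is
possible, the selection ends. This is the recursion `gain`; `SweepInv` shows that what it counts can
be realised, and `Continuation.card_le_gain` that nothing larger exists.

There are O(n²) states and n sweep positions, hence cubic time. Quadratic space suffices because
stage e reads, besides the entry being updated, only entries with e as one of their indices, and
these have reached their final value. An entry ends as the gain just after the larger of its two
indices, which is also the only kind of value needed to reconstruct an optimal set
(`tableCode_spec`, `stepBranch_spec`).

The algorithm is written in a small language with counted loops. `Code.exec_compile` transfers its
semantics to the machine, and loop depth 3 gives the time bound. -/

/-- No index below `n` has elements of `Q` in all four of its open quadrants, where the point with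
index `s` is `(s, Y s)`. -/
def Unsurrounded (n : ℕ) (Y : ℕ → ℕ) (Q : Finset ℕ) : Prop :=
  ∀ z < n, (∀ s ∈ Q, s < z → Y s ≤ Y z) ∨ (∀ s ∈ Q, s < z → Y z ≤ Y s) ∨
    (∀ s ∈ Q, z < s → Y s ≤ Y z) ∨ (∀ s ∈ Q, z < s → Y z ≤ Y s)

/-- The largest number of points with index at least `e` that can be added in a left-to-right sweep
with current lower point `lo` and current upper point `hi`. The flag `a` says that `hi` bounds the
remaining points from above, the flag `b` that `lo` bounds them from below. -/
def gain (n : ℕ) (Y : ℕ → ℕ) (e : ℕ) (a b : Bool) (lo hi : ℕ) : ℕ :=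
  if e < n then
    if Y e < Y lo then
      if b then gain n Y (e + 1) a b lo hi
      else max (max (gain n Y (e + 1) a b lo hi) (gain n Y (e + 1) a false e hi + 1))
        (gain n Y (e + 1) a true e hi + 1)
    else if Y hi < Y e then
      if a then gain n Y (e + 1) a b lo hi
      else max (max (gain n Y (e + 1) a b lo hi) (gain n Y (e + 1) false b lo e + 1))
        (gain n Y (e + 1) true b lo e + 1)
    else max (if a then gain n Y (e + 1) true b lo e + 1 else 0)
      (if b then gain n Y (e + 1) a true e hi + 1 else 0)
  else 0
termination_by n - e

theorem gain_of_le {n : ℕ} {Y : ℕ → ℕ} {e : ℕ} (h : n ≤ e) (a b : Bool) (lo hi : ℕ) :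
    gain n Y e a b lo hi = 0 := by
  rw [gain, if_neg (by omega)]

theorem gain_of_lt {n : ℕ} {Y : ℕ → ℕ} {e : ℕ} (h : e < n) (a b : Bool) (lo hi : ℕ) :
    gain n Y e a b lo hi =
      if Y e < Y lo then
        if b then gain n Y (e + 1) a b lo hi
        else max (max (gain n Y (e + 1) a b lo hi) (gain n Y (e + 1) a false e hi + 1))
          (gain n Y (e + 1) a true e hi + 1)
      else if Y hi < Y e then
        if a then gain n Y (e + 1) a b lo hi
        else max (max (gain n Y (e + 1) a b lo hi) (gain n Y (e + 1) false b lo e + 1))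
          (gain n Y (e + 1) true b lo e + 1)
      else max (if a then gain n Y (e + 1) true b lo e + 1 else 0)
        (if b then gain n Y (e + 1) a true e hi + 1 else 0) := by
  rw [gain, if_pos h]

theorem gain_le (n : ℕ) (Y : ℕ → ℕ) (e : ℕ) (a b : Bool) (lo hi : ℕ) :
    gain n Y e a b lo hi ≤ n - e := by
  induction hk : n - e generalizing e a b lo hi with
  | zero => rw [gain_of_le (by omega)]
  | succ k ih =>
    have ih' := fun a b lo hi => ih (e + 1) a b lo hi (by omega)
    rw [gain]
    have h1 := ih' a b lo hi
    have h2 := ih' a false e hi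
    have h3 := ih' a true e hi
    have h4 := ih' false b lo e
    have h5 := ih' true b lo e
    split_ifs <;> omega

/-! ### Soundness of the recursion: partial selections that remain unsurrounded. -/

/-- The invariant of the sweep: `Q` has been selected among the indices below `e`, and every
index below `e` keeps an empty quadrant whatever points are selected later. -/
structure SweepInv (n : ℕ) (Y : ℕ → ℕ) (e : ℕ) (a b : Bool) (lo hi : ℕ) (Q : Finset ℕ) :
    Prop where
  lt : ∀ q ∈ Q, q < e
  le : Y lo ≤ Y hi
  lo_lt : lo < e
  hi_lt : hi < e
  top : a = false → ∀ q ∈ Q, Y q ≤ Y hi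
  bot : b = false → ∀ q ∈ Q, Y lo ≤ Y q
  safe : ∀ z < e, (∀ s ∈ Q, s < z → Y s ≤ Y z) ∨ (∀ s ∈ Q, s < z → Y z ≤ Y s) ∨
    (a = true ∧ Y hi ≤ Y z ∧ ∀ s ∈ Q, z < s → Y s ≤ Y z) ∨
    (b = true ∧ Y z ≤ Y lo ∧ ∀ s ∈ Q, z < s → Y z ≤ Y s)

namespace SweepInv

variable {n : ℕ} {Y : ℕ → ℕ} {e : ℕ} {a b : Bool} {lo hi : ℕ} {Q : Finset ℕ}

/-- The sweep may stop at any time: indices from `e` on have no selected point to their right. -/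
theorem unsurrounded (h : SweepInv n Y e a b lo hi Q) : Unsurrounded n Y Q := by
  intro z _
  by_cases hz : z < e
  · rcases h.safe z hz with h1 | h1 | h1 | h1
    · exact Or.inl h1
    · exact Or.inr (Or.inl h1)
    · exact Or.inr (Or.inr (Or.inl h1.2.2))
    · exact Or.inr (Or.inr (Or.inr h1.2.2))
  · refine Or.inr (Or.inr (Or.inl fun s hs hzs => ?_))
    have := h.lt s hs
    omega

theorem init (l : ℕ) (a b : Bool) : SweepInv n Y (l + 1) a b l l {l} where
  lt := by simp
  le := le_rfl
  lo_lt := by omega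
  hi_lt := by omega
  top := by simp
  bot := by simp
  safe := by
    intro z hz
    left
    intro s hs hsz
    simp at hs
    omega

/-- The skipped point keeps its lower left quadrant empty if `lo` is the lowest selection so far,
and its lower right one if `lo` is a floor for the future. -/
theorem skip_below (h : SweepInv n Y e a b lo hi Q) (he : Y e < Y lo) :
    SweepInv n Y (e + 1) a b lo hi Q where
  lt q hq := by have := h.lt q hq; omega
  le := h.le
  lo_lt := by have := h.lo_lt; omega
  hi_lt := by have := h.hi_lt; omega
  top := h.top
  bot := h.bot
  safe := by
    intro z hz
    by_cases hze : z < e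
    · exact h.safe z hze
    obtain rfl : z = e := by omega
    cases hb : b
    · right; left
      intro s hs _
      have := h.bot hb s hs
      omega
    · right; right; right
      refine ⟨rfl, he.le, fun s hs hzs => ?_⟩
      have := h.lt s hs
      omega

theorem skip_above (h : SweepInv n Y e a b lo hi Q) (he : Y hi < Y e) :
    SweepInv n Y (e + 1) a b lo hi Q where
  lt q hq := by have := h.lt q hq; omega
  le := h.le
  lo_lt := by have := h.lo_lt; omega
  hi_lt := by have := h.hi_lt; omega
  top := h.top
  bot := h.bot
  safe := by
    intro z hz
    by_cases hze : z < e
    · exact h.safe z hze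
    obtain rfl : z = e := by omega
    cases ha : a
    · left
      intro s hs _
      have := h.top ha s hs
      omega
    · right; right; left
      refine ⟨rfl, he.le, fun s hs hzs => ?_⟩
      have := h.lt s hs
      omega

/-- The new point has an empty lower left quadrant. Earlier points that rely on the ceiling are at
least as high as `hi`, hence above the new point, and none relies on a floor since that flag was
false. -/
theorem take_below (h : SweepInv n Y e a false lo hi Q) (he : Y e < Y lo) (b' : Bool) :
    SweepInv n Y (e + 1) a b' e hi (insert e Q) where
  lt q hq := by
    rcases Finset.mem_insert.1 hq with rfl | hq
    · omega
    · have := h.lt q hq; omega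
  le := he.le.trans h.le
  lo_lt := by omega
  hi_lt := by have := h.hi_lt; omega
  top := by
    intro ha q hq
    rcases Finset.mem_insert.1 hq with rfl | hq
    · exact he.le.trans h.le
    · exact h.top ha q hq
  bot := by
    intro _ q hq
    rcases Finset.mem_insert.1 hq with rfl | hq
    · exact le_rfl
    · exact he.le.trans (h.bot rfl q hq)
  safe := by
    intro z hz
    simp only [Finset.forall_mem_insert]
    by_cases hze : z < e
    · rcases h.safe z hze with h1 | h1 | h1 | h1
      · exact Or.inl ⟨by omega, h1⟩
      · exact Or.inr (Or.inl ⟨by omega, h1⟩)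
      · refine Or.inr (Or.inr (Or.inl ⟨h1.1, h1.2.1, ?_, h1.2.2⟩))
        have := h.le
        omega
      · simp at h1
    obtain rfl : z = e := by omega
    right; left
    refine ⟨by omega, fun s hs _ => ?_⟩
    exact he.le.trans (h.bot rfl s hs)

theorem take_above (h : SweepInv n Y e false b lo hi Q) (he : Y hi < Y e) (a' : Bool) :
    SweepInv n Y (e + 1) a' b lo e (insert e Q) where
  lt q hq := by
    rcases Finset.mem_insert.1 hq with rfl | hq
    · omega
    · have := h.lt q hq; omega
  le := h.le.trans he.le
  hi_lt := by omega
  lo_lt := by have := h.lo_lt; omega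
  bot := by
    intro hb q hq
    rcases Finset.mem_insert.1 hq with rfl | hq
    · exact h.le.trans he.le
    · exact h.bot hb q hq
  top := by
    intro _ q hq
    rcases Finset.mem_insert.1 hq with rfl | hq
    · exact le_rfl
    · exact (h.top rfl q hq).trans he.le
  safe := by
    intro z hz
    simp only [Finset.forall_mem_insert]
    by_cases hze : z < e
    · rcases h.safe z hze with h1 | h1 | h1 | h1
      · exact Or.inl ⟨by omega, h1⟩
      · exact Or.inr (Or.inl ⟨by omega, h1⟩)
      · simp at h1
      · refine Or.inr (Or.inr (Or.inr ⟨h1.1, h1.2.1, ?_, h1.2.2⟩))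
        have := h.le
        omega
    obtain rfl : z = e := by omega
    left
    refine ⟨by omega, fun s hs _ => ?_⟩
    exact (h.top rfl s hs).trans he.le

/-- Lowering the ceiling to `e` preserves every earlier reason for safety: points relying on the old
ceiling lie no lower than `e`, points relying on the floor no higher. The point `e` itself relies on
the new ceiling. -/
theorem cap (h : SweepInv n Y e true b lo hi Q) (h1 : Y lo ≤ Y e) (h2 : Y e ≤ Y hi) :
    SweepInv n Y (e + 1) true b lo e (insert e Q) where
  lt q hq := by
    rcases Finset.mem_insert.1 hq with rfl | hq
    · omega
    · have := h.lt q hq; omega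
  le := h1
  hi_lt := by omega
  lo_lt := by have := h.lo_lt; omega
  bot := by
    intro hb q hq
    rcases Finset.mem_insert.1 hq with rfl | hq
    · exact h1
    · exact h.bot hb q hq
  top := by simp
  safe := by
    intro z hz
    simp only [Finset.forall_mem_insert]
    by_cases hze : z < e
    · rcases h.safe z hze with h3 | h3 | h3 | h3
      · exact Or.inl ⟨by omega, h3⟩
      · exact Or.inr (Or.inl ⟨by omega, h3⟩)
      · exact Or.inr (Or.inr (Or.inl ⟨by simp, by omega, by omega, h3.2.2⟩))
      · exact Or.inr (Or.inr (Or.inr ⟨h3.1, h3.2.1, by omega, h3.2.2⟩))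
    obtain rfl : z = e := by omega
    right; right; left
    refine ⟨by simp, le_rfl, by omega, fun s hs hzs => ?_⟩
    have := h.lt s hs
    omega

theorem floor (h : SweepInv n Y e a true lo hi Q) (h1 : Y lo ≤ Y e) (h2 : Y e ≤ Y hi) :
    SweepInv n Y (e + 1) a true e hi (insert e Q) where
  lt q hq := by
    rcases Finset.mem_insert.1 hq with rfl | hq
    · omega
    · have := h.lt q hq; omega
  le := h2
  lo_lt := by omega
  hi_lt := by have := h.hi_lt; omega
  top := by
    intro ha q hq
    rcases Finset.mem_insert.1 hq with rfl | hq
    · exact h2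
    · exact h.top ha q hq
  bot := by simp
  safe := by
    intro z hz
    simp only [Finset.forall_mem_insert]
    by_cases hze : z < e
    · rcases h.safe z hze with h3 | h3 | h3 | h3
      · exact Or.inl ⟨by omega, h3⟩
      · exact Or.inr (Or.inl ⟨by omega, h3⟩)
      · exact Or.inr (Or.inr (Or.inl ⟨h3.1, h3.2.1, by omega, h3.2.2⟩))
      · exact Or.inr (Or.inr (Or.inr ⟨by simp, by omega, by omega, h3.2.2⟩))
    obtain rfl : z = e := by omega
    right; right; right
    refine ⟨by simp, le_rfl, by omega, fun s hs hzs => ?_⟩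
    have := h.lt s hs
    omega

end SweepInv

/-! ### Completeness of the recursion: no admissible set exceeds it. -/

/-- `R` is a set of indices at least `e` that can still be selected when the sweep is in the given
state, and the flags are those that `R` determines. -/
structure Continuation (n : ℕ) (Y : ℕ → ℕ) (e : ℕ) (a b : Bool) (lo hi : ℕ) (R : Finset ℕ) :
    Prop where
  mem : ∀ r ∈ R, e ≤ r ∧ r < n
  le : Y lo ≤ Y hi
  cap : a = true → ∀ r ∈ R, Y r < Y hi
  top : a = false → ∃ r ∈ R, Y hi < Y r
  floor : b = true → ∀ r ∈ R, Y lo < Y r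
  bot : b = false → ∃ r ∈ R, Y r < Y lo
  -- The disjunct `a = true` stands for an occupied upper left quadrant: a point of `R` to the upper
  -- right of `z` is then below `hi`, so `hi` is above `z`. Likewise for `b`. Thus selected points
  -- other than `lo` and `hi` need not be remembered.
  free : ∀ z, e ≤ z → z < n → (a = true ∨ Y z < Y hi ∨ ∃ r ∈ R, r < z ∧ Y z < Y r) →
    (b = true ∨ Y lo < Y z ∨ ∃ r ∈ R, r < z ∧ Y r < Y z) →
    (∃ r ∈ R, z < r ∧ Y z < Y r) → (∃ r ∈ R, z < r ∧ Y r < Y z) → False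

namespace Continuation

variable {n : ℕ} {Y : ℕ → ℕ} {e : ℕ} {a b : Bool} {lo hi : ℕ} {R : Finset ℕ}

theorem skip (h : Continuation n Y e a b lo hi R) (he : e ∉ R) :
    Continuation n Y (e + 1) a b lo hi R where
  mem r hr := by
    have := h.mem r hr
    have : r ≠ e := by rintro rfl; exact he hr
    omega
  le := h.le
  cap := h.cap
  top := h.top
  floor := h.floor
  bot := h.bot
  free z hz := h.free z (by omega)

theorem mem_erase (h : Continuation n Y e a b lo hi R) : ∀ r ∈ R.erase e, e + 1 ≤ r ∧ r < n := by
  intro r hr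
  rw [Finset.mem_erase] at hr
  have := h.mem r hr.2
  omega

end Continuation

-- Induction along the sweep. Outside the band between `lo` and `hi` the recursion imitates `R`,
-- choosing the flags that the rest of `R` determines. Inside the band it takes `e` even if `R` does
-- not, which cannot decrease the count.
set_option maxHeartbeats 800000 in
theorem Continuation.card_le_gain {n : ℕ} {Y : ℕ → ℕ} (hY : Set.InjOn Y (Set.Iio n)) {e : ℕ}
    {a b : Bool} {lo hi : ℕ} {R : Finset ℕ} (hlo : lo < e) (hhi : hi < e)
    (h : Continuation n Y e a b lo hi R) : R.card ≤ gain n Y e a b lo hi := by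
  induction hk : n - e generalizing e a b lo hi R with
  | zero =>
    have : R = ∅ := Finset.eq_empty_of_forall_notMem fun r hr => by
      have := h.mem r hr; omega
    simp [this]
  | succ k ih =>
    have hen : e < n := by omega
    have hle := h.le
    have inj : ∀ r, r < n → r ≠ e → Y r ≠ Y e := fun r hr hre hY' => hre (hY hr hen hY')
    have key : ∀ {a b lo hi R}, lo < e + 1 → hi < e + 1 → Continuation n Y (e + 1) a b lo hi R →
        R.card ≤ gain n Y (e + 1) a b lo hi := fun h1 h2 h3 => ih h1 h2 h3 (by omega)
    -- Covers both `e ∈ R` and `e ∉ R`, so the steps inside the band need no case distinction on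
    -- membership.
    have hcard : R.card ≤ (R.erase e).card + 1 := by
      have := Finset.pred_card_le_card_erase (s := R) (a := e); omega
    rw [gain_of_lt hen]
    split_ifs with h1 hb h2 ha
    · refine key (by omega) (by omega) (h.skip fun he => ?_)
      have := h.floor hb e he; omega
    · by_cases he : e ∈ R
      · have hb : b = false := by simpa using hb
        subst hb
        -- The new flag records whether `e` is lower than everything still to come.
        obtain ⟨b', hb'⟩ : ∃ b' : Bool, b' = true ↔ ∀ r ∈ R.erase e, Y e < Y r :=
          ⟨decide (∀ r ∈ R.erase e, Y e < Y r), by simp⟩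
        have hc : Continuation n Y (e + 1) a b' e hi (R.erase e) := by
          refine ⟨h.mem_erase, by omega, fun ha r hr => h.cap ha r (Finset.mem_of_mem_erase hr),
            fun ha => ?_, hb'.1, fun hf => ?_, ?_⟩
          · obtain ⟨r, hr, hr'⟩ := h.top ha
            refine ⟨r, Finset.mem_erase.2 ⟨?_, hr⟩, hr'⟩
            rintro rfl; omega
          · have : ¬ ∀ r ∈ R.erase e, Y e < Y r := fun hh => by simp [hb'.2 hh] at hf
            push Not at this
            obtain ⟨r, hr, hr'⟩ := this
            refine ⟨r, hr, lt_of_le_of_ne hr' (inj r (h.mem_erase r hr).2 ?_)⟩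
            exact (Finset.mem_erase.1 hr).1
          · rintro z hz hzn hl hr ⟨u, hu, hu'⟩ ⟨w, hw, hw'⟩
            refine h.free z (by omega) hzn ?_ (Or.inr (Or.inr ?_))
              ⟨u, Finset.mem_of_mem_erase hu, hu'⟩ ⟨w, Finset.mem_of_mem_erase hw, hw'⟩
            · rcases hl with hl | hl | ⟨r, hr, hr'⟩
              · exact Or.inl hl
              · exact Or.inr (Or.inl hl)
              · exact Or.inr (Or.inr ⟨r, Finset.mem_of_mem_erase hr, hr'⟩)
            · rcases hr with hr | hr | ⟨r, hr, hr'⟩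
              · exact ⟨e, he, by omega, (hb'.1 hr w hw).trans hw'.2⟩
              · exact ⟨e, he, by omega, hr⟩
              · exact ⟨r, Finset.mem_of_mem_erase hr, hr'⟩
        have := key (by omega) (by omega) hc
        cases b' <;> omega
      · have := key (by omega) (by omega) (h.skip he)
        omega
    · refine key (by omega) (by omega) (h.skip fun he => ?_)
      have := h.cap ha e he; omega
    · by_cases he : e ∈ R
      · have ha : a = false := by simpa using ha
        subst ha
        obtain ⟨a', ha'⟩ : ∃ a' : Bool, a' = true ↔ ∀ r ∈ R.erase e, Y r < Y e :=
          ⟨decide (∀ r ∈ R.erase e, Y r < Y e), by simp⟩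
        have hc : Continuation n Y (e + 1) a' b lo e (R.erase e) := by
          refine ⟨h.mem_erase, by omega, ha'.1, fun hf => ?_,
            fun hb r hr => h.floor hb r (Finset.mem_of_mem_erase hr), fun hb => ?_, ?_⟩
          · have : ¬ ∀ r ∈ R.erase e, Y r < Y e := fun hh => by simp [ha'.2 hh] at hf
            push Not at this
            obtain ⟨r, hr, hr'⟩ := this
            refine ⟨r, hr, lt_of_le_of_ne hr' (inj r (h.mem_erase r hr).2 ?_).symm⟩
            exact (Finset.mem_erase.1 hr).1
          · obtain ⟨r, hr, hr'⟩ := h.bot hb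
            refine ⟨r, Finset.mem_erase.2 ⟨?_, hr⟩, hr'⟩
            rintro rfl; omega
          · rintro z hz hzn hl hr ⟨u, hu, hu'⟩ ⟨w, hw, hw'⟩
            refine h.free z (by omega) hzn (Or.inr (Or.inr ?_)) ?_
              ⟨u, Finset.mem_of_mem_erase hu, hu'⟩ ⟨w, Finset.mem_of_mem_erase hw, hw'⟩
            · rcases hl with hl | hl | ⟨r, hr, hr'⟩
              · exact ⟨e, he, by omega, hu'.2.trans (ha'.1 hl u hu)⟩
              · exact ⟨e, he, by omega, hl⟩
              · exact ⟨r, Finset.mem_of_mem_erase hr, hr'⟩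
            · rcases hr with hr | hr | ⟨r, hr, hr'⟩
              · exact Or.inl hr
              · exact Or.inr (Or.inl hr)
              · exact Or.inr (Or.inr ⟨r, Finset.mem_of_mem_erase hr, hr'⟩)
        have := key (by omega) (by omega) hc
        cases a' <;> omega
      · have := key (by omega) (by omega) (h.skip he)
        omega
    all_goals
      have hlt : Y lo < Y e := lt_of_le_of_ne (by omega) (inj lo (by omega) (by omega))
      have hgt : Y e < Y hi := lt_of_le_of_ne (by omega) (inj hi (by omega) (by omega)).symm
      have hfree := h.free e le_rfl hen (Or.inr (Or.inl hgt)) (Or.inr (Or.inl hlt))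
      -- If all the rest lies below `e`, nothing exceeds `hi`, which is incompatible with `a =
      -- false`.
      have capstep : (∀ r ∈ R.erase e, Y r < Y e) →
          a = true ∧ R.card ≤ gain n Y (e + 1) true b lo e + 1 := by
        intro hR
        have ha : a = true := by
          by_contra ha
          obtain ⟨r, hr, hr'⟩ := h.top (by simpa using ha)
          have := hR r (Finset.mem_erase.2 ⟨by rintro rfl; omega, hr⟩)
          omega
        refine ⟨ha, ?_⟩
        have := key (a := true) (b := b) (lo := lo) (hi := e) (R := R.erase e) (by omega) (by omega)
          ⟨h.mem_erase, hlt.le, fun _ => hR, by simp,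
            fun hb r hr => h.floor hb r (Finset.mem_of_mem_erase hr), fun hb => by
              obtain ⟨r, hr, hr'⟩ := h.bot hb
              exact ⟨r, Finset.mem_erase.2 ⟨by rintro rfl; omega, hr⟩, hr'⟩, by
            rintro z hz hzn _ hr ⟨u, hu, hu'⟩ ⟨w, hw, hw'⟩
            refine h.free z (by omega) hzn (Or.inl ha) ?_
              ⟨u, Finset.mem_of_mem_erase hu, hu'⟩ ⟨w, Finset.mem_of_mem_erase hw, hw'⟩
            rcases hr with hr | hr | ⟨r, hr, hr'⟩
            · exact Or.inl hr
            · exact Or.inr (Or.inl hr)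
            · exact Or.inr (Or.inr ⟨r, Finset.mem_of_mem_erase hr, hr'⟩)⟩
        omega
      have floorstep : (∀ r ∈ R.erase e, Y e < Y r) →
          b = true ∧ R.card ≤ gain n Y (e + 1) a true e hi + 1 := by
        intro hR
        have hb : b = true := by
          by_contra hb
          obtain ⟨r, hr, hr'⟩ := h.bot (by simpa using hb)
          have := hR r (Finset.mem_erase.2 ⟨by rintro rfl; omega, hr⟩)
          omega
        refine ⟨hb, ?_⟩
        have := key (a := a) (b := true) (lo := e) (hi := hi) (R := R.erase e) (by omega) (by omega)
          ⟨h.mem_erase, hgt.le, fun ha r hr => h.cap ha r (Finset.mem_of_mem_erase hr), fun ha => by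
              obtain ⟨r, hr, hr'⟩ := h.top ha
              exact ⟨r, Finset.mem_erase.2 ⟨by rintro rfl; omega, hr⟩, hr'⟩,
            fun _ => hR, by simp, by
            rintro z hz hzn hl _ ⟨u, hu, hu'⟩ ⟨w, hw, hw'⟩
            refine h.free z (by omega) hzn ?_ (Or.inl hb)
              ⟨u, Finset.mem_of_mem_erase hu, hu'⟩ ⟨w, Finset.mem_of_mem_erase hw, hw'⟩
            rcases hl with hl | hl | ⟨r, hr, hr'⟩
            · exact Or.inl hl
            · exact Or.inr (Or.inl hl)
            · exact Or.inr (Or.inr ⟨r, Finset.mem_of_mem_erase hr, hr'⟩)⟩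
        omega
      -- Here `lo` and `hi` occupy both left quadrants of `e`, so the rest of `R` cannot meet both
      -- right quadrants.
      have hor : (∀ r ∈ R.erase e, Y r < Y e) ∨ (∀ r ∈ R.erase e, Y e < Y r) := by
        by_contra hcon
        push Not at hcon
        obtain ⟨⟨u, hu, hu'⟩, w, hw, hw'⟩ := hcon
        have hue := h.mem_erase u hu
        have hwe := h.mem_erase w hw
        have := inj u (by omega) (by omega)
        have := inj w (by omega) (by omega)
        exact hfree ⟨u, Finset.mem_of_mem_erase hu, by omega, by omega⟩
          ⟨w, Finset.mem_of_mem_erase hw, by omega, by omega⟩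
      rcases hor with hR | hR
      · have := capstep hR
        first | omega | exact absurd this.1 ‹_›
      · have := floorstep hR
        first | omega | exact absurd this.1 ‹_›

/-- The leftmost point of `Q` serves as both `lo` and `hi` of the initial state, with the flags
determined by the other points. -/
theorem Unsurrounded.exists_card_le {n : ℕ} {Y : ℕ → ℕ} (hY : Set.InjOn Y (Set.Iio n))
    {Q : Finset ℕ} (hQ : ∀ q ∈ Q, q < n) (h : Unsurrounded n Y Q) (hne : Q.Nonempty) :
    ∃ l < n, ∃ a b, Q.card ≤ gain n Y (l + 1) a b l l + 1 := by
  set l := Q.min' hne with hl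
  have hlQ : l ∈ Q := Q.min'_mem hne
  have hln := hQ l hlQ
  have hmem : ∀ r ∈ Q.erase l, l + 1 ≤ r ∧ r < n := fun r hr => by
    have h1 := Finset.mem_erase.1 hr
    have h2 := Q.min'_le r h1.2
    have := hQ r h1.2
    omega
  have inj : ∀ r ∈ Q.erase l, Y r ≠ Y l := fun r hr hY' => by
    have := hmem r hr
    have := hY (show r < n by omega) hln hY'
    omega
  obtain ⟨a, ha⟩ : ∃ a : Bool, a = true ↔ ∀ r ∈ Q.erase l, Y r < Y l :=
    ⟨decide (∀ r ∈ Q.erase l, Y r < Y l), by simp⟩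
  obtain ⟨b, hb⟩ : ∃ b : Bool, b = true ↔ ∀ r ∈ Q.erase l, Y l < Y r :=
    ⟨decide (∀ r ∈ Q.erase l, Y l < Y r), by simp⟩
  refine ⟨l, hln, a, b, ?_⟩
  have hc : Continuation n Y (l + 1) a b l l (Q.erase l) := by
    refine ⟨hmem, le_rfl, ha.1, fun hf => ?_, hb.1, fun hf => ?_, ?_⟩
    · have : ¬ ∀ r ∈ Q.erase l, Y r < Y l := fun hh => by simp [ha.2 hh] at hf
      push Not at this
      obtain ⟨r, hr, hr'⟩ := this
      exact ⟨r, hr, lt_of_le_of_ne hr' (inj r hr).symm⟩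
    · have : ¬ ∀ r ∈ Q.erase l, Y l < Y r := fun hh => by simp [hb.2 hh] at hf
      push Not at this
      obtain ⟨r, hr, hr'⟩ := this
      exact ⟨r, hr, lt_of_le_of_ne hr' (inj r hr)⟩
    · rintro z hz hzn hL hR ⟨u, hu, hu'⟩ ⟨w, hw, hw'⟩
      have hL' : ∃ s ∈ Q, s < z ∧ Y z < Y s := by
        rcases hL with hL | hL | ⟨r, hr, hr'⟩
        · exact ⟨l, hlQ, by omega, hu'.2.trans (ha.1 hL u hu)⟩
        · exact ⟨l, hlQ, by omega, hL⟩
        · exact ⟨r, Finset.mem_of_mem_erase hr, hr'⟩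
      have hR' : ∃ s ∈ Q, s < z ∧ Y s < Y z := by
        rcases hR with hR | hR | ⟨r, hr, hr'⟩
        · exact ⟨l, hlQ, by omega, (hb.1 hR w hw).trans hw'.2⟩
        · exact ⟨l, hlQ, by omega, hR⟩
        · exact ⟨r, Finset.mem_of_mem_erase hr, hr'⟩
      obtain ⟨s, hs, hs1, hs2⟩ := hL'
      obtain ⟨t, ht, ht1, ht2⟩ := hR'
      rcases h z hzn with h1 | h1 | h1 | h1
      · have := h1 s hs hs1; omega
      · have := h1 t ht ht1; omega
      · have := h1 u (Finset.mem_of_mem_erase hu) hu'.1; omega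
      · have := h1 w (Finset.mem_of_mem_erase hw) hw'.1; omega
  have := hc.card_le_gain hY (by omega) (by omega)
  have := Finset.card_erase_add_one hlQ
  omega

/-! ### From hulls to ranks -/

theorem isClosed_quadrantUnion {S : Set (ℝ × ℝ)} (hS : S.Finite) (i : Fin 4) :
    IsClosed (quadrantUnion i S) :=
  hS.isClosed_biUnion fun _ _ => isClosed_closure

theorem isClosed_rch {S : Set (ℝ × ℝ)} (hS : S.Finite) : IsClosed (rch S) :=
  isClosed_iInter fun i => isClosed_quadrantUnion hS i

theorem closure_quadrant (i : Fin 4) (p : ℝ × ℝ) :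
    closure (quadrant i p) = match i with
      | 0 => Set.Ici p.1 ×ˢ Set.Ici p.2
      | 1 => Set.Iic p.1 ×ˢ Set.Ici p.2
      | 2 => Set.Iic p.1 ×ˢ Set.Iic p.2
      | 3 => Set.Ici p.1 ×ˢ Set.Iic p.2 := by
  fin_cases i <;> simp [quadrant, closure_prod_eq]

theorem isOpen_quadrant (i : Fin 4) (p : ℝ × ℝ) : IsOpen (quadrant i p) := by
  fin_cases i
  · exact isOpen_Ioi.prod isOpen_Ioi
  · exact isOpen_Iio.prod isOpen_Ioi
  · exact isOpen_Iio.prod isOpen_Iio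
  · exact isOpen_Ioi.prod isOpen_Iio

theorem mem_interior_rch {S : Set (ℝ × ℝ)} {z : ℝ × ℝ} (h : ∀ i, ∃ s ∈ S, z ∈ quadrant i s) :
    z ∈ interior (rch S) := by
  choose s hs hz using h
  refine mem_interior.2 ⟨⋂ i, quadrant i (s i), ?_,
    isOpen_iInter_of_finite fun i => isOpen_quadrant i (s i), Set.mem_iInter.2 hz⟩
  exact Set.iInter_mono fun i =>
    subset_closure.trans (Set.subset_biUnion_of_mem (u := fun p => closure (quadrant i p)) (hs i))

/-- Move `z` slightly towards the apex of the quadrant. The moved point is still in the hull, hence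
in a closed quadrant of some `s`, and moving back makes both inequalities strict. -/
theorem exists_mem_quadrant {S : Set (ℝ × ℝ)} {z : ℝ × ℝ} (h : z ∈ interior (rch S)) (i : Fin 4) :
    ∃ s ∈ S, z ∈ quadrant i s := by
  obtain ⟨ε, hε, hb⟩ := Metric.mem_nhds_iff.1 (mem_interior_iff_mem_nhds.1 h)
  have key : ∀ σ τ : ℝ, |σ| < ε → |τ| < ε → (z.1 + σ, z.2 + τ) ∈ quadrantUnion i S := by
    intro σ τ hσ hτ
    refine Set.mem_iInter.1 (hb ?_) i
    rw [Metric.mem_ball, Prod.dist_eq]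
    simp [hσ, hτ]
  have h1 : |ε / 2| < ε := by rw [abs_of_pos (by linarith)]; linarith
  have h2 : |-(ε / 2)| < ε := by rwa [abs_neg]
  simp only [quadrantUnion, Set.mem_iUnion, closure_quadrant] at key
  fin_cases i
  · obtain ⟨s, hs, hs1, hs2⟩ := key _ _ h2 h2
    simp only [Set.mem_Ici] at hs1 hs2
    exact ⟨s, hs, by simp only [Set.mem_Ioi]; linarith, by simp only [Set.mem_Ioi]; linarith⟩
  · obtain ⟨s, hs, hs1, hs2⟩ := key _ _ h1 h2
    simp only [Set.mem_Ici, Set.mem_Iic] at hs1 hs2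
    exact ⟨s, hs, by simp only [Set.mem_Iio]; linarith, by simp only [Set.mem_Ioi]; linarith⟩
  · obtain ⟨s, hs, hs1, hs2⟩ := key _ _ h1 h1
    simp only [Set.mem_Iic] at hs1 hs2
    exact ⟨s, hs, by simp only [Set.mem_Iio]; linarith, by simp only [Set.mem_Iio]; linarith⟩
  · obtain ⟨s, hs, hs1, hs2⟩ := key _ _ h2 h1
    simp only [Set.mem_Ici, Set.mem_Iic] at hs1 hs2
    exact ⟨s, hs, by simp only [Set.mem_Ioi]; linarith, by simp only [Set.mem_Iio]; linarith⟩

theorem mem_interior_rch_iff {S : Set (ℝ × ℝ)} {z : ℝ × ℝ} :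
    z ∈ interior (rch S) ↔ ∀ i, ∃ s ∈ S, z ∈ quadrant i s :=
  ⟨fun h i => exists_mem_quadrant h i, mem_interior_rch⟩

theorem subset_rch (S : Set (ℝ × ℝ)) : S ⊆ rch S := by
  intro s hs
  refine Set.mem_iInter.2 fun i => Set.mem_biUnion hs ?_
  rw [closure_quadrant]
  fin_cases i <;> simp [Set.mem_prod]

/-- A point of `P` outside `S` shares no coordinate with a point of `S`, so the closed quadrants
that contain it contain it in their interior; being in the hull would make it an interior point. -/
theorem inter_rch_subset {P S : Set (ℝ × ℝ)} (h1 : Set.InjOn Prod.fst P)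
    (h2 : Set.InjOn Prod.snd P) (hSP : S ⊆ P) (he : IsEmptyRCH P S) : P ∩ rch S ⊆ S := by
  rintro z ⟨hzP, hz⟩
  by_contra hzS
  refine Set.eq_empty_iff_forall_notMem.1 he z ⟨hzP, mem_interior_rch fun i => ?_⟩
  obtain ⟨s, hs, hzs⟩ := Set.mem_iUnion₂.1 (Set.mem_iInter.1 hz i)
  have hne : s ≠ z := by rintro rfl; exact hzS hs
  have hx : s.1 ≠ z.1 := fun h => hne (h1 (hSP hs) hzP h)
  have hy : s.2 ≠ z.2 := fun h => hne (h2 (hSP hs) hzP h)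
  refine ⟨s, hs, ?_⟩
  rw [closure_quadrant] at hzs
  fin_cases i
  · exact ⟨lt_of_le_of_ne hzs.1 hx, lt_of_le_of_ne hzs.2 hy⟩
  · exact ⟨lt_of_le_of_ne hzs.1 hx.symm, lt_of_le_of_ne hzs.2 hy⟩
  · exact ⟨lt_of_le_of_ne hzs.1 hx.symm, lt_of_le_of_ne hzs.2 hy.symm⟩
  · exact ⟨lt_of_le_of_ne hzs.1 hx, lt_of_le_of_ne hzs.2 hy.symm⟩

/-- The hull of a finite set is closed, so its frontier is the hull minus its interior; emptiness
and `inter_rch_subset` reduce this to `S`. -/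
theorem rchSize_eq_ncard {P S : Set (ℝ × ℝ)} (hP : P.Finite) (h1 : Set.InjOn Prod.fst P)
    (h2 : Set.InjOn Prod.snd P) (hSP : S ⊆ P) (he : IsEmptyRCH P S) : rchSize P S = S.ncard := by
  have hS := hP.subset hSP
  rw [rchSize, (isClosed_rch hS).frontier_eq]
  congr 1
  refine Set.Subset.antisymm (fun z hz => inter_rch_subset h1 h2 hSP he ⟨hz.1, hz.2.1⟩)
    fun z hz => ⟨hSP hz, subset_rch S hz, fun hi => ?_⟩
  exact Set.eq_empty_iff_forall_notMem.1 he z ⟨hSP hz, hi⟩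

/-- The number of indices with a smaller value. -/
noncomputable def rank {n : ℕ} (f : Fin n → ℝ) (i : Fin n) : ℕ :=
  open Classical in (Finset.univ.filter fun j => f j < f i).card

theorem rank_lt {n : ℕ} (f : Fin n → ℝ) (i : Fin n) : rank f i < n := by
  classical
  have : (Finset.univ.filter fun j => f j < f i) ⊂ Finset.univ := by
    rw [Finset.filter_ssubset]
    exact ⟨i, Finset.mem_univ i, lt_irrefl _⟩
  simpa [rank] using Finset.card_lt_card this

theorem rank_lt_rank {n : ℕ} {f : Fin n → ℝ} {i j : Fin n} : rank f i < rank f j ↔ f i < f j := by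
  classical
  have mono : ∀ {i j : Fin n}, f i ≤ f j → rank f i ≤ rank f j := fun h =>
    Finset.card_le_card fun k hk => by
      simp only [Finset.mem_filter, Finset.mem_univ, true_and] at hk ⊢
      exact hk.trans_le h
  refine ⟨fun h => ?_, fun h => Finset.card_lt_card ?_⟩
  · by_contra hc
    exact absurd (mono (not_lt.1 hc)) (by omega)
  · refine (Finset.ssubset_iff_of_subset fun k hk => ?_).2 ⟨i, by simpa using h, by simp⟩
    simp only [Finset.mem_filter, Finset.mem_univ, true_and] at hk ⊢
    exact hk.trans h

theorem rank_injective {n : ℕ} {f : Fin n → ℝ} (hf : Function.Injective f) :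
    Function.Injective (rank f) := fun i j h => hf <| le_antisymm
  (not_lt.1 fun h' => by have := rank_lt_rank.2 h'; omega)
  (not_lt.1 fun h' => by have := rank_lt_rank.2 h'; omega)

theorem exists_rank_eq {n : ℕ} {f : Fin n → ℝ} (hf : Function.Injective f) {k : ℕ} (hk : k < n) :
    ∃ i, rank f i = k := by
  have hinj : Function.Injective fun i => (⟨rank f i, rank_lt f i⟩ : Fin n) := fun i j h =>
    rank_injective hf (by simpa using h)
  obtain ⟨i, hi⟩ := (Finite.injective_iff_surjective.1 hinj) ⟨k, hk⟩
  exact ⟨i, by simpa using hi⟩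

section

variable {n : ℕ} {p : Fin n → ℝ × ℝ} {Y : ℕ → ℕ}

theorem isEmptyRCH_iff (hp : GeneralPosition p)
    (hY : ∀ i, Y (rank (fun i => (p i).1) i) = rank (fun i => (p i).2) i) (Q : Finset ℕ)
    (hQ : ∀ q ∈ Q, q < n) :
    IsEmptyRCH (Set.range p) (p '' {i | rank (fun i => (p i).1) i ∈ Q}) ↔ Unsurrounded n Y Q := by
  have hx : ∀ i j, (p i).1 < (p j).1 ↔ rank (fun i => (p i).1) i < rank (fun i => (p i).1) j :=
    fun i j => (rank_lt_rank (f := fun i => (p i).1)).symm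
  have hy : ∀ i j, (p i).2 < (p j).2 ↔
      Y (rank (fun i => (p i).1) i) < Y (rank (fun i => (p i).1) j) := fun i j => by
    rw [hY, hY]
    exact (rank_lt_rank (f := fun i => (p i).2)).symm
  have hall : ∀ (q : ℕ → Prop), (∀ z < n, q z) ↔ ∀ i, q (rank (fun i => (p i).1) i) := fun q =>
    ⟨fun h i => h _ (rank_lt _ i), fun h z hz => by
      obtain ⟨i, rfl⟩ := exists_rank_eq hp.1 hz
      exact h i⟩
  have hallQ : ∀ (q : ℕ → Prop), (∀ s ∈ Q, q s) ↔
      ∀ i, rank (fun i => (p i).1) i ∈ Q → q (rank (fun i => (p i).1) i) := fun q =>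
    ⟨fun h i hi => h _ hi, fun h s hs => by
      obtain ⟨i, rfl⟩ := exists_rank_eq hp.1 (hQ s hs)
      exact h i hs⟩
  rw [IsEmptyRCH, Set.eq_empty_iff_forall_notMem, Unsurrounded, hall]
  simp only [hallQ, Set.mem_inter_iff, not_and, Set.forall_mem_range, mem_interior_rch_iff,
    Set.exists_mem_image, Set.mem_ofPred_eq]
  refine forall_congr' fun i => ?_
  constructor
  · intro h
    by_contra hc
    push Not at hc
    obtain ⟨⟨u, hu⟩, ⟨v, hv⟩, ⟨w, hw⟩, ⟨t, ht⟩⟩ := hc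
    refine h fun k => ?_
    fin_cases k
    -- Apex and point exchange roles: the point is in the upper right quadrant of `s` when `s` is to
    -- its lower left. So quadrant 0 pairs with the second alternative of `Unsurrounded`, quadrant 1
    -- with the fourth, 2 with the third and 3 with the first.
    · exact ⟨v, hv.1, (hx _ _).2 hv.2.1, (hy _ _).2 hv.2.2⟩
    · exact ⟨t, ht.1, (hx _ _).2 ht.2.1, (hy _ _).2 ht.2.2⟩
    · exact ⟨w, hw.1, (hx _ _).2 hw.2.1, (hy _ _).2 hw.2.2⟩
    · exact ⟨u, hu.1, (hx _ _).2 hu.2.1, (hy _ _).2 hu.2.2⟩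
  · intro h hc
    obtain ⟨v, hv, hv1, hv2⟩ := hc 0
    obtain ⟨t, ht, ht1, ht2⟩ := hc 1
    obtain ⟨w, hw, hw1, hw2⟩ := hc 2
    obtain ⟨u, hu, hu1, hu2⟩ := hc 3
    rcases h with h | h | h | h
    · exact absurd (h u hu ((hx _ _).1 hu1)) (not_le.2 ((hy _ _).1 hu2))
    · exact absurd (h v hv ((hx _ _).1 hv1)) (not_le.2 ((hy _ _).1 hv2))
    · exact absurd (h w hw ((hx _ _).1 hw1)) (not_le.2 ((hy _ _).1 hw2))
    · exact absurd (h t ht ((hx _ _).1 ht1)) (not_le.2 ((hy _ _).1 ht2))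

theorem ncard_image_rank_mem (hp : GeneralPosition p) (Q : Finset ℕ) (hQ : ∀ q ∈ Q, q < n) :
    (p '' {i | rank (fun i => (p i).1) i ∈ Q}).ncard = Q.card := by
  have hinj : Function.Injective p := fun i j h => hp.1 (congrArg Prod.fst h)
  rw [Set.ncard_image_of_injective _ hinj,
    ← Set.ncard_image_of_injective _ (rank_injective hp.1), ← Set.ncard_coe_finset]
  congr 1
  ext k
  constructor
  · rintro ⟨i, hi, rfl⟩
    exact hi
  · intro hk
    obtain ⟨i, rfl⟩ := exists_rank_eq hp.1 (hQ k hk)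
    exact ⟨i, hk, rfl⟩

theorem isMaxEmptyRCH_image (hp : GeneralPosition p)
    (hY : ∀ i, Y (rank (fun i => (p i).1) i) = rank (fun i => (p i).2) i) {Q : Finset ℕ}
    (hQ : ∀ q ∈ Q, q < n) (hU : Unsurrounded n Y Q)
    (hmax : ∀ Q' : Finset ℕ, (∀ q ∈ Q', q < n) → Unsurrounded n Y Q' → Q'.card ≤ Q.card) :
    IsMaxEmptyRCH (Set.range p) (p '' {i | rank (fun i => (p i).1) i ∈ Q}) := by
  classical
  have h1 : Set.InjOn Prod.fst (Set.range p) := by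
    rintro _ ⟨i, rfl⟩ _ ⟨j, rfl⟩ h
    rw [hp.1 h]
  have h2 : Set.InjOn Prod.snd (Set.range p) := by
    rintro _ ⟨i, rfl⟩ _ ⟨j, rfl⟩ h
    rw [hp.2 h]
  have hf := Set.finite_range p
  have hE := (isEmptyRCH_iff hp hY Q hQ).2 hU
  refine ⟨Set.image_subset_range _ _, hE, fun S' hS' hE' => ?_⟩
  obtain ⟨I, rfl⟩ : ∃ I : Set (Fin n), p '' I = S' := Set.subset_range_iff_exists_image_eq.1 hS'
  set Q' : Finset ℕ := (Finset.univ.filter (· ∈ I)).image (rank fun i => (p i).1) with hQ'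
  have hQn : ∀ q ∈ Q', q < n := by
    intro q hq
    obtain ⟨i, _, rfl⟩ := Finset.mem_image.1 hq
    exact rank_lt _ i
  have hI : I = {i | rank (fun i => (p i).1) i ∈ Q'} := by
    ext i
    simp [hQ', (rank_injective hp.1).eq_iff]
  rw [rchSize_eq_ncard hf h1 h2 hS' hE',
    rchSize_eq_ncard hf h1 h2 (Set.image_subset_range _ _) hE, hI, ncard_image_rank_mem hp Q' hQn,
    ncard_image_rank_mem hp Q hQ]
  rw [hI] at hE'
  exact hmax Q' hQn ((isEmptyRCH_iff hp hY Q' hQn).1 hE')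

end
/-! ### A small structured language that compiles to the machine -/

/-- Operands: variables, the constants `0` and `1`, and the number `n` of points. -/
inductive Opd : Type
  | var (x : Fin 32)
  | zero
  | one
  | size

/-- Right-hand sides of assignments: `succ` is the successor truncated at `n + 1`. -/
inductive Rhs : Type
  | opd (o : Opd)
  | succ (o : Opd)
  | sub (o o' : Opd)
  | get (k : Fin 8) (i j : Opd)

/-- Conditions: comparisons of operands, or of coordinates of the points with given indices. -/
inductive Cond : Type
  | lt (o o' : Opd)
  | eq (o o' : Opd)
  | xlt (o o' : Opd)
  | ylt (o o' : Opd)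

/-- Structured programs with variables, two-dimensional arrays, and loops in which the loop
variable takes the values `0, …, n - 1`. -/
inductive Code : Type
  | skip
  | seq (c d : Code)
  | set (x : Fin 32) (r : Rhs)
  | put (k : Fin 8) (i j o : Opd)
  | ite (s : Cond) (c d : Code)
  | loop (x : Fin 32) (c : Code)

/-- The values of the variables and of the arrays. -/
@[ext] structure Store : Type where
  var : Fin 32 → ℕ
  arr : Fin 8 → ℕ → ℕ → ℕ

/-- Assignment to a variable. -/
def Store.setVar (σ : Store) (x : Fin 32) (v : ℕ) : Store :=
  ⟨fun y => if y = x then v else σ.var y, σ.arr⟩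

/-- Assignment to an array entry. -/
def Store.setArr (σ : Store) (k : Fin 8) (i j v : ℕ) : Store :=
  ⟨σ.var, fun k' i' j' => if k' = k ∧ i' = i ∧ j' = j then v else σ.arr k' i' j'⟩

def Opd.val (n : ℕ) (σ : Store) : Opd → ℕ
  | .var x => σ.var x
  | .zero => 0
  | .one => 1
  | .size => n

def Rhs.val (n : ℕ) (σ : Store) : Rhs → ℕ
  | .opd o => o.val n σ
  | .succ o => min (o.val n σ + 1) (n + 1)
  | .sub o o' => o.val n σ - o'.val n σ
  | .get k i j => σ.arr k (i.val n σ) (j.val n σ)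

/-- Comparison of the values of `f` at two indices, false if an index is out of range. -/
def IdxLT {n : ℕ} (f : Fin n → ℝ) (i j : ℕ) : Prop :=
  ∃ (hi : i < n) (hj : j < n), f ⟨i, hi⟩ < f ⟨j, hj⟩

def Cond.holds {n : ℕ} (p : Fin n → ℝ × ℝ) (σ : Store) : Cond → Prop
  | .lt o o' => o.val n σ < o'.val n σ
  | .eq o o' => o.val n σ = o'.val n σ
  | .xlt o o' => IdxLT (fun i => (p i).1) (o.val n σ) (o'.val n σ)
  | .ylt o o' => IdxLT (fun i => (p i).2) (o.val n σ) (o'.val n σ)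

/-- `k` rounds of a loop with loop variable `x` and body `f`. -/
def rounds (x : Fin 32) (f : Store → Store) : ℕ → Store → Store
  | 0, σ => σ
  | k + 1, σ => f ((rounds x f k σ).setVar x k)

open Classical in
/-- The store that results from running a program. -/
noncomputable def Code.run {n : ℕ} (p : Fin n → ℝ × ℝ) : Code → Store → Store
  | .skip, σ => σ
  | .seq c d, σ => d.run p (c.run p σ)
  | .set x r, σ => σ.setVar x (r.val n σ)
  | .put k i j o, σ => σ.setArr k (i.val n σ) (j.val n σ) (o.val n σ)
  | .ite s c d, σ => if s.holds p σ then c.run p σ else d.run p σ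
  | .loop x c, σ => (rounds x (c.run p) n σ).setVar x n

/-- The program does not assign to the variable `x`. -/
def Code.keeps (x : Fin 32) : Code → Bool
  | .skip => true
  | .seq c d => c.keeps x && d.keeps x
  | .set y _ => decide (y ≠ x)
  | .put _ _ _ _ => true
  | .ite _ c d => c.keeps x && d.keeps x
  | .loop y c => decide (y ≠ x) && c.keeps x

/-- Loop variables are not assigned to in the loop body. -/
def Code.wf : Code → Bool
  | .skip => true
  | .seq c d => c.wf && d.wf
  | .set _ _ => true
  | .put _ _ _ _ => true
  | .ite _ c d => c.wf && d.wf
  | .loop x c => c.keeps x && c.wf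

theorem rounds_keeps {x y : Fin 32} (hxy : y ≠ x) {f : Store → Store}
    (hf : ∀ σ, (f σ).var x = σ.var x) (k : ℕ) (σ : Store) :
    (rounds y f k σ).var x = σ.var x := by
  induction k with
  | zero => rfl
  | succ k ih => rw [rounds, hf]; simp [Store.setVar, hxy.symm, ih]

theorem Code.run_keeps {n : ℕ} (p : Fin n → ℝ × ℝ) {x : Fin 32} {c : Code} (h : c.keeps x = true)
    (σ : Store) : (c.run p σ).var x = σ.var x := by
  induction c generalizing σ with
  | skip => rfl
  | seq c d ihc ihd =>
    simp only [keeps, Bool.and_eq_true] at h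
    rw [run, ihd h.2, ihc h.1]
  | set y r =>
    simp only [keeps, decide_eq_true_eq] at h
    simp [run, Store.setVar, h.symm]
  | put => rfl
  | ite s c d ihc ihd =>
    simp only [keeps, Bool.and_eq_true] at h
    rw [run]
    split_ifs
    · exact ihc h.1 σ
    · exact ihd h.2 σ
  | loop y c ih =>
    simp only [keeps, Bool.and_eq_true, decide_eq_true_eq] at h
    rw [run, ← rounds_keeps h.1 (ih h.2) n σ]
    simp [Store.setVar, h.1.symm]

/-! ### Compilation -/

/-- Memory layout: cell 0 keeps `n`, cells 1 to 32 hold the variables, and the arrays start at cell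
64, each a square of side `n + 2` since every value is at most `n + 1`. -/
def Opd.expr : Opd → Expr
  | .var x => .load (.lit (x + 1))
  | .zero => .lit 0
  | .one => .lit 1
  | .size => .load (.lit 0)

/-- The address of an array entry. -/
def adr (n k i j : ℕ) : ℕ := 64 + ((k * (n + 2) + i) * (n + 2) + j)

def adrExpr (k : ℕ) (i j : Expr) : Expr :=
  .add (.lit 64) (.add (.mul (.add (.mul (.lit k) (.add (.load (.lit 0)) (.lit 2))) i)
    (.add (.load (.lit 0)) (.lit 2))) j)

/-- For the truncated successor, the second difference is 1 exactly at the value `n + 1` and 0 below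
it. -/
def Rhs.expr : Rhs → Expr
  | .opd o => o.expr
  | .succ o => .sub (.add o.expr (.lit 1)) (.sub o.expr (.load (.lit 0)))
  | .sub o o' => .sub o.expr o'.expr
  | .get k i j => .load (adrExpr k i.expr j.expr)

/-- Coordinate comparisons are guarded, because the machine is stuck on an index that is out of
range. -/
def Cond.branch (c d : Prog) : Cond → Prog
  | .lt o o' => .ite (.lt o.expr o'.expr) c d
  | .eq o o' => .ite (.eq o.expr o'.expr) c d
  | .xlt o o' => .ite (.lt o.expr Opd.size.expr)
      (.ite (.lt o'.expr Opd.size.expr) (.ite (.xlt o.expr o'.expr) c d) d) d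
  | .ylt o o' => .ite (.lt o.expr Opd.size.expr)
      (.ite (.lt o'.expr Opd.size.expr) (.ite (.ylt o.expr o'.expr) c d) d) d

def Code.compile : Code → Prog
  | .skip => .skip
  | .seq c d => .seq c.compile d.compile
  | .set x r => .store (.lit (x + 1)) r.expr
  | .put k i j o => .store (adrExpr k i.expr j.expr) o.expr
  | .ite s c d => s.branch c.compile d.compile
  | .loop x c => .seq (.store (.lit (x + 1)) (.lit 0))
      (.while (.lt (.load (.lit (x + 1))) (.load (.lit 0)))
        (.seq c.compile (.store (.lit (x + 1)) (.add (.load (.lit (x + 1))) (.lit 1)))))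

/-- A bound for the running time of the compiled program. -/
def Code.time (n : ℕ) : Code → ℕ
  | .skip => 1
  | .seq c d => c.time n + d.time n
  | .set _ _ => 30
  | .put _ _ _ _ => 30
  | .ite _ c d => c.time n + d.time n + 30
  | .loop _ c => n * (c.time n + 20) + 20

/-- The coefficient in the bound `Code.time_le`. -/
def Code.coeff : Code → ℕ
  | .skip => 1
  | .seq c d => c.coeff + d.coeff
  | .set _ _ => 30
  | .put _ _ _ _ => 30
  | .ite _ c d => c.coeff + d.coeff + 30
  | .loop _ c => c.coeff + 40

/-- The nesting depth of loops. -/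
def Code.depth : Code → ℕ
  | .skip => 0
  | .seq c d => max c.depth d.depth
  | .set _ _ => 0
  | .put _ _ _ _ => 0
  | .ite _ c d => max c.depth d.depth
  | .loop _ c => c.depth + 1

theorem Code.time_le (n : ℕ) (c : Code) : c.time n ≤ c.coeff * (n + 1) ^ c.depth := by
  have mono : ∀ {a b : ℕ}, a ≤ b → (n + 1) ^ a ≤ (n + 1) ^ b := fun h =>
    Nat.pow_le_pow_right (by omega) h
  induction c with
  | skip => simp [time, coeff, depth]
  | seq c d ihc ihd =>
    rw [time, coeff, depth, add_mul]
    exact add_le_add (ihc.trans (Nat.mul_le_mul_left _ (mono (le_max_left _ _))))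
      (ihd.trans (Nat.mul_le_mul_left _ (mono (le_max_right _ _))))
  | set => simp [time, coeff, depth]
  | put => simp [time, coeff, depth]
  | ite s c d ihc ihd =>
    rw [time, coeff, depth, add_mul, add_mul]
    refine add_le_add (add_le_add (ihc.trans (Nat.mul_le_mul_left _ (mono (le_max_left _ _))))
      (ihd.trans (Nat.mul_le_mul_left _ (mono (le_max_right _ _))))) ?_
    exact Nat.le_mul_of_pos_right _ (by positivity)
  | loop x c ih =>
    rw [time, coeff, depth, pow_succ]
    have h1 : 1 ≤ (n + 1) ^ c.depth := Nat.one_le_pow _ _ (by omega)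
    nlinarith

/-! ### Correctness of the compiler. -/

/-- The memory content `mem` represents the store `σ`. -/
structure Represents (n : ℕ) (σ : Store) (mem : ℕ → ℕ) : Prop where
  size : mem 0 = n
  var : ∀ x : Fin 32, mem (x + 1) = σ.var x
  arr : ∀ (k : Fin 8) (i j : ℕ), i ≤ n + 1 → j ≤ n + 1 → mem (adr n k i j) = σ.arr k i j
  var_le : ∀ x, σ.var x ≤ n + 1
  arr_le : ∀ k i j, σ.arr k i j ≤ n + 1

theorem adr_lt {n i j : ℕ} (k : Fin 8) (hi : i ≤ n + 1) (hj : j ≤ n + 1) :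
    adr n k i j < 64 + 8 * (n + 2) ^ 2 := by
  have := k.2
  have : (k : ℕ) * (n + 2) + i + 1 ≤ 8 * (n + 2) := by nlinarith
  rw [adr]
  nlinarith

theorem adr_inj {n i j i' j' : ℕ} {k k' : Fin 8} (hi : i ≤ n + 1) (hj : j ≤ n + 1)
    (hi' : i' ≤ n + 1) (hj' : j' ≤ n + 1) :
    adr n k i j = adr n k' i' j' ↔ k = k' ∧ i = i' ∧ j = j' := by
  refine ⟨fun h => ?_, by rintro ⟨rfl, rfl, rfl⟩; rfl⟩
  have split : ∀ {a b c d : ℕ}, b < n + 2 → d < n + 2 → a * (n + 2) + b = c * (n + 2) + d →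
      a = c ∧ b = d := by
    intro a b c d hb hd h
    have h1 := congrArg (· / (n + 2)) h
    have h2 := congrArg (· % (n + 2)) h
    simp only [Nat.mul_add_mod_self_right, Nat.mod_eq_of_lt hb, Nat.mod_eq_of_lt hd] at h2
    subst h2
    exact ⟨Nat.eq_of_mul_eq_mul_right (by omega) (Nat.add_right_cancel h), rfl⟩
  obtain ⟨h1, h2⟩ := split (by omega) (by omega) (Nat.add_left_cancel h)
  obtain ⟨h3, h4⟩ := split (by omega) (by omega) h1
  exact ⟨Fin.ext h3, h4, h2⟩

theorem Opd.val_le {n : ℕ} {σ : Store} {mem : ℕ → ℕ} (h : Represents n σ mem) (o : Opd) :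
    o.val n σ ≤ n + 1 := by
  cases o with
  | var x => exact h.var_le x
  | zero => simp [val]
  | one => simp [val]
  | size => simp [val]

theorem Rhs.val_le {n : ℕ} {σ : Store} {mem : ℕ → ℕ} (h : Represents n σ mem) (r : Rhs) :
    r.val n σ ≤ n + 1 := by
  cases r with
  | opd o => exact o.val_le h
  | succ o => exact min_le_right _ _
  | sub o o' => exact (Nat.sub_le _ _).trans (o.val_le h)
  | get k i j => exact h.arr_le _ _ _

namespace Represents

variable {n M : ℕ} {σ : Store} {mem : ℕ → ℕ}

theorem setVar (h : Represents n σ mem) (x : Fin 32) {v : ℕ} (hv : v ≤ n + 1) :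
    Represents n (σ.setVar x v) (Function.update mem (x + 1) v) where
  size := by rw [Function.update_of_ne (by omega), h.size]
  var y := by
    by_cases hy : y = x
    · subst hy
      simp [Store.setVar]
    · rw [Function.update_of_ne (by simpa [Fin.ext_iff] using hy), h.var]
      simp [Store.setVar, hy]
  arr k i j hi hj := by
    rw [Function.update_of_ne (by have := x.2; rw [adr]; omega), h.arr k i j hi hj]
    rfl
  var_le y := by
    simp only [Store.setVar]
    split_ifs
    exacts [hv, h.var_le y]
  arr_le := h.arr_le

theorem setArr (h : Represents n σ mem) (k : Fin 8) {i j v : ℕ} (hi : i ≤ n + 1) (hj : j ≤ n + 1)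
    (hv : v ≤ n + 1) :
    Represents n (σ.setArr k i j v) (Function.update mem (adr n k i j) v) where
  size := by rw [Function.update_of_ne (by rw [adr]; omega), h.size]
  var y := by
    rw [Function.update_of_ne (by have := y.2; rw [adr]; omega), h.var]
    rfl
  arr k' i' j' hi' hj' := by
    simp only [Store.setArr, ← adr_inj hi' hj' hi hj, Function.update_apply,
      h.arr k' i' j' hi' hj']
  var_le := h.var_le
  arr_le k' i' j' := by
    simp only [Store.setArr]
    split_ifs
    exacts [hv, h.arr_le _ _ _]

theorem eval_opd (h : Represents n σ mem) (hM : 64 + 8 * (n + 2) ^ 2 ≤ M) (o : Opd) :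
    o.expr.eval M mem = some (o.val n σ) := by
  have : 0 < (n + 2) ^ 2 := by positivity
  cases o with
  | var x =>
    have := x.2
    simp [Opd.expr, Expr.eval, word, Opd.val, h.var, show (x : ℕ) + 1 < M by omega]
  | zero => simp [Opd.expr, Expr.eval, word, Opd.val, show 0 < M by omega]
  | one => simp [Opd.expr, Expr.eval, word, Opd.val, show 1 < M by omega]
  | size => simp [Opd.expr, Expr.eval, word, Opd.val, h.size, show 0 < M by omega]

theorem eval_adr (hsize : mem 0 = n) (hM : 64 + 8 * (n + 2) ^ 2 ≤ M) {k : ℕ} (hk : k < 8)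
    {a b : Expr} {i j : ℕ} (ha : a.eval M mem = some i) (hb : b.eval M mem = some j)
    (hi : i ≤ n + 1) (hj : j ≤ n + 1) :
    (adrExpr k a b).eval M mem = some (adr n k i j) := by
  have h1 : adr n k i j < M := (adr_lt ⟨k, hk⟩ hi hj).trans_le hM
  have h2 : (k * (n + 2) + i) ≤ (k * (n + 2) + i) * (n + 2) := Nat.le_mul_of_pos_right _ (by omega)
  have h0 : n + 2 ≤ (n + 2) ^ 2 := Nat.le_self_pow (by omega) _
  rw [adr] at h1
  simp [adrExpr, Expr.eval, word, ha, hb, hsize, adr, show 64 < M by omega, show 0 < M by omega,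
    show 2 < M by omega, show n + 2 < M by omega, show k * (n + 2) < M by omega,
    show k * (n + 2) + i < M by omega, show (k * (n + 2) + i) * (n + 2) < M by omega,
    show (k * (n + 2) + i) * (n + 2) + j < M by omega, h1, show k < M by omega]

theorem eval_rhs (h : Represents n σ mem) (hM : 64 + 8 * (n + 2) ^ 2 ≤ M) (r : Rhs) :
    r.expr.eval M mem = some (r.val n σ) := by
  have h0 : n + 2 ≤ (n + 2) ^ 2 := Nat.le_self_pow (by omega) _
  cases r with
  | opd o => exact h.eval_opd hM o
  | succ o =>
    have := o.val_le h
    simp only [Rhs.expr, Expr.eval, h.eval_opd hM, word, h.size, show 0 < M by omega,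
      show 1 < M by omega, if_true, Option.bind_some, Option.map_some,
      show o.val n σ + 1 < M by omega, show o.val n σ - n < M by omega,
      show o.val n σ + 1 - (o.val n σ - n) < M by omega, Rhs.val]
    congr 1
    omega
  | sub o o' =>
    have := o.val_le h
    simp [Rhs.expr, Expr.eval, h.eval_opd hM, word, Rhs.val,
      show o.val n σ - o'.val n σ < M by omega]
  | get k i j =>
    rw [Rhs.expr, Expr.eval, eval_adr h.size hM k.2 (h.eval_opd hM i) (h.eval_opd hM j)
      (i.val_le h) (j.val_le h), Option.map_some, h.arr k _ _ (i.val_le h) (j.val_le h)]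
    rfl

end Represents

theorem Opd.cost_expr_le (o : Opd) : o.expr.cost ≤ 2 := by cases o <;> simp [expr, Expr.cost]

theorem adrExpr_cost (k : ℕ) (a b : Expr) : (adrExpr k a b).cost = a.cost + b.cost + 15 := by
  simp only [adrExpr, Expr.cost]
  omega

theorem Rhs.cost_expr_le (r : Rhs) : r.expr.cost ≤ 20 := by
  cases r with
  | opd o => have := o.cost_expr_le; rw [expr]; omega
  | succ o => have := o.cost_expr_le; simp only [expr, Expr.cost]; omega
  | sub o o' =>
    have := o.cost_expr_le
    have := o'.cost_expr_le
    simp only [expr, Expr.cost]; omega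
  | get k i j =>
    have := i.cost_expr_le
    have := j.cost_expr_le
    simp only [expr, Expr.cost, adrExpr_cost]; omega

theorem Exec.guarded {n : ℕ} {p : Fin n → ℝ × ℝ} {M : ℕ} {mem mem' : ℕ → ℕ} {s : Test}
    {a b N : Expr} {i j : ℕ} {q : (i < n) → (j < n) → Prop} {c d : Prog} {t : ℕ}
    (ha : a.eval M mem = some i) (hb : b.eval M mem = some j) (hN : N.eval M mem = some n)
    (hac : a.cost ≤ 2) (hbc : b.cost ≤ 2) (hNc : N.cost ≤ 2) (hsc : s.cost ≤ 5)
    (hs : ∀ hi hj, ∃ β : Bool, s.eval p M mem = some β ∧ (β = true ↔ q hi hj))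
    (hc : (∃ hi hj, q hi hj) → Exec p M c mem t mem')
    (hd : (¬ ∃ hi hj, q hi hj) → Exec p M d mem t mem') :
    ∃ t' ≤ t + 25, Exec p M (.ite (.lt a N) (.ite (.lt b N) (.ite s c d) d) d) mem t' mem' := by
  by_cases hi : i < n
  · by_cases hj : j < n
    · obtain ⟨β, h1, h2⟩ := hs hi hj
      have : Exec p M (.ite s c d) mem (s.cost + 1 + t) mem' := by
        cases β
        · exact .ite_false h1 (hd fun ⟨_, _, h⟩ => by simpa using h2.2 h)
        · exact .ite_true h1 (hc ⟨hi, hj, h2.1 rfl⟩)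
      refine ⟨_, ?_, .ite_true (by simp [Test.eval, ha, hN, hi])
        (.ite_true (by simp [Test.eval, hb, hN, hj]) this)⟩
      simp only [Test.cost]
      omega
    · refine ⟨_, ?_, .ite_true (by simp [Test.eval, ha, hN, hi])
        (.ite_false (by simp [Test.eval, hb, hN]; omega) (hd fun ⟨_, h, _⟩ => hj h))⟩
      simp only [Test.cost]
      omega
  · refine ⟨_, ?_, .ite_false (by simp [Test.eval, ha, hN]; omega) (hd fun ⟨h, _⟩ => hi h)⟩
    simp only [Test.cost]
    omega

theorem Cond.exec_branch {n : ℕ} {p : Fin n → ℝ × ℝ} {M : ℕ} {σ : Store} {mem mem' : ℕ → ℕ}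
    {c d : Prog} {t : ℕ} (hM : 64 + 8 * (n + 2) ^ 2 ≤ M) (h : Represents n σ mem) (s : Cond)
    (hc : s.holds p σ → Exec p M c mem t mem') (hd : ¬ s.holds p σ → Exec p M d mem t mem') :
    ∃ t' ≤ t + 30, Exec p M (s.branch c d) mem t' mem' := by
  have hN := h.eval_opd hM .size
  cases s with
  | lt o o' =>
    have h1 := h.eval_opd hM o
    have h2 := h.eval_opd hM o'
    have := o.cost_expr_le
    have := o'.cost_expr_le
    by_cases hs : o.val n σ < o'.val n σ
    · refine ⟨_, ?_, .ite_true (by simp [Test.eval, h1, h2, hs]) (hc hs)⟩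
      simp only [Test.cost]; omega
    · refine ⟨_, ?_, .ite_false (by simp [Test.eval, h1, h2]; omega) (hd hs)⟩
      simp only [Test.cost]; omega
  | eq o o' =>
    have h1 := h.eval_opd hM o
    have h2 := h.eval_opd hM o'
    have := o.cost_expr_le
    have := o'.cost_expr_le
    by_cases hs : o.val n σ = o'.val n σ
    · refine ⟨_, ?_, .ite_true (by simp [Test.eval, h1, h2, hs]) (hc hs)⟩
      simp only [Test.cost]; omega
    · refine ⟨_, ?_, .ite_false (by simp [Test.eval, h1, h2]; omega) (hd hs)⟩
      simp only [Test.cost]; omega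
  | xlt o o' =>
    have h1 := h.eval_opd hM o
    have h2 := h.eval_opd hM o'
    have c1 := o.cost_expr_le
    have c2 := o'.cost_expr_le
    obtain ⟨t', ht', he⟩ := Exec.guarded (s := .xlt o.expr o'.expr) h1 h2 hN c1 c2
      (Opd.cost_expr_le _) (by simp only [Test.cost]; omega)
      (fun hi hj => ⟨decide ((p ⟨_, hi⟩).1 < (p ⟨_, hj⟩).1), by
        simp only [Test.eval, h1, h2, Option.bind_some]
        exact dif_pos ⟨hi, hj⟩, decide_eq_true_iff⟩) hc hd
    exact ⟨t', by omega, he⟩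
  | ylt o o' =>
    have h1 := h.eval_opd hM o
    have h2 := h.eval_opd hM o'
    have c1 := o.cost_expr_le
    have c2 := o'.cost_expr_le
    obtain ⟨t', ht', he⟩ := Exec.guarded (s := .ylt o.expr o'.expr) h1 h2 hN c1 c2
      (Opd.cost_expr_le _) (by simp only [Test.cost]; omega)
      (fun hi hj => ⟨decide ((p ⟨_, hi⟩).2 < (p ⟨_, hj⟩).2), by
        simp only [Test.eval, h1, h2, Option.bind_some]
        exact dif_pos ⟨hi, hj⟩, decide_eq_true_iff⟩) hc hd
    exact ⟨t', by omega, he⟩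

theorem Store.setVar_setVar (σ : Store) (x : Fin 32) (v w : ℕ) :
    (σ.setVar x v).setVar x w = σ.setVar x w := by
  ext y
  · simp only [setVar]; split_ifs <;> rfl
  · rfl

/-- Structural induction. The bound on `M` makes all addresses and intermediate results valid words,
and well-formedness ensures that a loop body leaves the loop counter intact. -/
theorem Code.exec_compile {n : ℕ} (p : Fin n → ℝ × ℝ) {M : ℕ} (hM : 64 + 8 * (n + 2) ^ 2 ≤ M)
    (c : Code) (hwf : c.wf = true) (σ : Store) (mem : ℕ → ℕ) (h : Represents n σ mem) :
    ∃ t ≤ c.time n, ∃ mem', Exec p M c.compile mem t mem' ∧ Represents n (c.run p σ) mem' := by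
  have h0 : n + 2 ≤ (n + 2) ^ 2 := Nat.le_self_pow (by omega) _
  have hlit : ∀ (x : Fin 32) (mem : ℕ → ℕ),
      (Expr.lit (x + 1)).eval M mem = some ((x : ℕ) + 1) := fun x mem => by
    have := x.2
    simp [Expr.eval, word, show (x : ℕ) + 1 < M by omega]
  have hload : ∀ (x : Fin 32) (mem : ℕ → ℕ),
      (Expr.load (.lit (x + 1))).eval M mem = some (mem (x + 1)) := fun x mem => by
    rw [Expr.eval, hlit, Option.map_some]
  induction c generalizing σ mem with
  | skip => exact ⟨1, le_rfl, mem, .skip mem, h⟩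
  | seq c d ihc ihd =>
    simp only [wf, Bool.and_eq_true] at hwf
    obtain ⟨t, ht, mem', he, h'⟩ := ihc hwf.1 σ mem h
    obtain ⟨t', ht', mem'', he', h''⟩ := ihd hwf.2 _ mem' h'
    exact ⟨t + t', add_le_add ht ht', mem'', .seq he he', h''⟩
  | set x r =>
    refine ⟨_, ?_, _, .store (hlit x mem) (h.eval_rhs hM r), h.setVar x (r.val_le h)⟩
    have := r.cost_expr_le
    simp only [Expr.cost, time]
    omega
  | put k i j o =>
    refine ⟨_, ?_, _, .store (Represents.eval_adr h.size hM k.2 (h.eval_opd hM i) (h.eval_opd hM j)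
      (i.val_le h) (j.val_le h)) (h.eval_opd hM o),
      h.setArr k (i.val_le h) (j.val_le h) (o.val_le h)⟩
    have := i.cost_expr_le
    have := j.cost_expr_le
    have := o.cost_expr_le
    rw [adrExpr_cost, time]
    omega
  | ite s c d ihc ihd =>
    simp only [wf, Bool.and_eq_true] at hwf
    by_cases hs : s.holds p σ
    · obtain ⟨t, ht, mem', he, h'⟩ := ihc hwf.1 σ mem h
      obtain ⟨t', ht', he'⟩ := s.exec_branch (d := d.compile) hM h (fun _ => he)
        (fun hn => absurd hs hn)
      refine ⟨t', ?_, mem', he', ?_⟩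
      · rw [time]; omega
      · rwa [run, if_pos hs]
    · obtain ⟨t, ht, mem', he, h'⟩ := ihd hwf.2 σ mem h
      obtain ⟨t', ht', he'⟩ := s.exec_branch (c := c.compile) hM h (fun hn => absurd hn hs)
        (fun _ => he)
      refine ⟨t', ?_, mem', he', ?_⟩
      · rw [time]; omega
      · rwa [run, if_neg hs]
  | loop x c ih =>
    simp only [wf, Bool.and_eq_true] at hwf
    -- Induction on the number `m` of remaining rounds, starting from the store after `k` rounds
    -- with the counter already set to `k`.
    have key : ∀ m, ∀ k, m + k = n → ∀ mem,
        Represents n ((rounds x (c.run p) k σ).setVar x k) mem →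
        ∃ t ≤ m * (c.time n + 20) + 10, ∃ mem',
          Exec p M (.while (.lt (.load (.lit (x + 1))) (.load (.lit 0)))
            (.seq c.compile (.store (.lit (x + 1)) (.add (.load (.lit (x + 1))) (.lit 1)))))
            mem t mem' ∧ Represents n ((rounds x (c.run p) n σ).setVar x n) mem' := by
      intro m
      induction m with
      | zero =>
        intro k hk mem h
        obtain rfl : k = n := by omega
        have hv := h.var x
        simp only [Store.setVar, if_true] at hv
        refine ⟨_, ?_, mem, .while_false ?_, h⟩
        · simp [Test.cost, Expr.cost]
        · rw [Test.eval, hload]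
          simp [Expr.eval, hv, word, h.size, show 0 < M by omega]
      | succ m ihm =>
        intro k hk mem h
        have hv := h.var x
        simp only [Store.setVar, if_true] at hv
        obtain ⟨t, ht, mem', he, h'⟩ := ih hwf.2 _ mem h
        have hv' := h'.var x
        rw [run_keeps p hwf.1] at hv'
        simp only [Store.setVar, if_true] at hv'
        have h'' := h'.setVar x (v := k + 1) (by omega)
        obtain ⟨t', ht', mem'', he', hr⟩ := ihm (k + 1) (by omega) _ h''
        refine ⟨_, ?_, mem'', .while_true ?_ (.seq he (.store (hlit x mem') (v := k + 1) ?_)) he',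
          hr⟩
        · simp only [Test.cost, Expr.cost]
          rw [add_mul]
          omega
        · rw [Test.eval, hload]
          simp [Expr.eval, hv, word, h.size, show 0 < M by omega]
          omega
        · rw [Expr.eval, hload]
          simp [Expr.eval, hv', word, show 1 < M by omega, show k + 1 < M by omega]
    obtain ⟨t, ht, mem', he, h'⟩ := key n 0 (by omega) _ (h.setVar x (Nat.zero_le _))
    refine ⟨_, ?_, mem', .seq (.store (hlit x mem) (v := 0)
      (by simp [Expr.eval, word, show 0 < M by omega])) he, h'⟩
    simp only [Expr.cost, time]
    omega

/-! ### Frame and loop rules -/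

/-- The program does not write to the array `k`. -/
def Code.keepsArr (k : Fin 8) : Code → Bool
  | .skip => true
  | .seq c d => c.keepsArr k && d.keepsArr k
  | .set _ _ => true
  | .put k' _ _ _ => decide (k' ≠ k)
  | .ite _ c d => c.keepsArr k && d.keepsArr k
  | .loop _ c => c.keepsArr k

theorem Code.run_keepsArr {n : ℕ} (p : Fin n → ℝ × ℝ) {k : Fin 8} {c : Code}
    (h : c.keepsArr k = true) (σ : Store) : (c.run p σ).arr k = σ.arr k := by
  induction c generalizing σ with
  | skip => rfl
  | seq c d ihc ihd =>
    simp only [keepsArr, Bool.and_eq_true] at h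
    rw [run, ihd h.2, ihc h.1]
  | set y r => rfl
  | put k' i j o =>
    simp only [keepsArr, decide_eq_true_eq] at h
    funext i' j'
    simp [run, Store.setArr, h.symm]
  | ite s c d ihc ihd =>
    simp only [keepsArr, Bool.and_eq_true] at h
    rw [run]
    split_ifs
    · exact ihc h.1 σ
    · exact ihd h.2 σ
  | loop y c ih =>
    have : ∀ m, (rounds y (c.run p) m σ).arr k = σ.arr k := by
      intro m
      induction m with
      | zero => rfl
      | succ m ihm => rw [rounds, ih h]; exact ihm
    exact this n

/-- The last hypothesis is needed because a loop leaves its variable at `n`. -/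
theorem Code.loop_rule {n : ℕ} {p : Fin n → ℝ × ℝ} {x : Fin 32} {c : Code} {σ : Store}
    (I : ℕ → Store → Prop) (h0 : I 0 σ)
    (hs : ∀ k < n, ∀ τ, I k τ → I (k + 1) (c.run p (τ.setVar x k)))
    (hx : ∀ τ v, I n τ → I n (τ.setVar x v)) : I n ((Code.loop x c).run p σ) := by
  have : ∀ m ≤ n, I m (rounds x (c.run p) m σ) := by
    intro m
    induction m with
    | zero => exact fun _ => h0
    | succ m ih => exact fun hm => hs m (by omega) _ (ih (by omega))
  exact hx _ _ (this n le_rfl)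

@[simp] theorem Store.setVar_arr (σ : Store) (x : Fin 32) (v : ℕ) : (σ.setVar x v).arr = σ.arr := rfl

@[simp] theorem Store.setVar_self (σ : Store) (x : Fin 32) (v : ℕ) : (σ.setVar x v).var x = v := by
  simp [setVar]

theorem Store.setVar_ne (σ : Store) {x y : Fin 32} (v : ℕ) (h : y ≠ x) :
    (σ.setVar x v).var y = σ.var y := by
  simp [setVar, h]

/-! ### Sorting by abscissa -/

/-- Ranks are found by counting, in quadratic time. Row 0 of array 2 lists the input indices by
abscissa; row 0 of array 3 lists the corresponding ranks of ordinates, the function `Y` of the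
recursion. -/
def rankCode : Code :=
  .loop 0 <| .seq (.set 3 (.opd .zero)) <| .seq (.set 4 (.opd .zero)) <|
    .seq (.loop 1 <|
      .seq (.ite (.xlt (.var 1) (.var 0)) (.set 3 (.succ (.var 3))) .skip)
        (.ite (.ylt (.var 1) (.var 0)) (.set 4 (.succ (.var 4))) .skip)) <|
    .seq (.put 2 .zero (.var 3) (.var 0)) (.put 3 .zero (.var 3) (.var 4))

/-- The number of indices below `k` with a smaller value. -/
noncomputable def partialRank {n : ℕ} (f : Fin n → ℝ) (i : Fin n) (k : ℕ) : ℕ :=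
  open Classical in (Finset.univ.filter fun j : Fin n => (j : ℕ) < k ∧ f j < f i).card

theorem partialRank_zero {n : ℕ} (f : Fin n → ℝ) (i : Fin n) : partialRank f i 0 = 0 := by
  simp [partialRank]

theorem partialRank_self {n : ℕ} (f : Fin n → ℝ) (i : Fin n) : partialRank f i n = rank f i := by
  simp [partialRank, rank]

theorem partialRank_le {n : ℕ} (f : Fin n → ℝ) (i : Fin n) (k : ℕ) : partialRank f i k ≤ n := by
  classical
  simpa [partialRank] using
    Finset.card_filter_le Finset.univ fun j : Fin n => (j : ℕ) < k ∧ f j < f i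

open Classical in
theorem partialRank_succ {n : ℕ} (f : Fin n → ℝ) (i : Fin n) {k : ℕ} (hk : k < n) :
    partialRank f i (k + 1) = partialRank f i k + if f ⟨k, hk⟩ < f i then 1 else 0 := by
  have hfin : ∀ j : Fin n, (j : ℕ) = k ↔ j = ⟨k, hk⟩ := fun j => by rw [Fin.ext_iff]
  split_ifs with h
  · rw [partialRank, partialRank, ← Finset.card_insert_of_notMem (a := ⟨k, hk⟩) (by simp)]
    congr 1
    ext j
    simp only [Finset.mem_filter, Finset.mem_univ, true_and, Finset.mem_insert, ← hfin]
    constructor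
    · rintro ⟨h1, h2⟩
      by_cases hj : (j : ℕ) = k
      · exact Or.inl hj
      · exact Or.inr ⟨by omega, h2⟩
    · rintro (h1 | h1)
      · rw [(hfin j).1 h1]
        exact ⟨by simp, h⟩
      · exact ⟨by omega, h1.2⟩
  · rw [partialRank, partialRank, add_zero]
    congr 1
    ext j
    simp only [Finset.mem_filter, Finset.mem_univ, true_and]
    constructor
    · rintro ⟨h1, h2⟩
      have : (j : ℕ) ≠ k := fun hj => h ((hfin j).1 hj ▸ h2)
      exact ⟨by omega, h2⟩
    · rintro ⟨h1, h2⟩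
      exact ⟨by omega, h2⟩

theorem idxLT_iff {n : ℕ} (f : Fin n → ℝ) {i j : ℕ} (hi : i < n) (hj : j < n) :
    IdxLT f i j ↔ f ⟨i, hi⟩ < f ⟨j, hj⟩ :=
  ⟨fun ⟨_, _, h⟩ => h, fun h => ⟨hi, hj, h⟩⟩

theorem rankCode_spec {n : ℕ} {p : Fin n → ℝ × ℝ} (hp : GeneralPosition p) (σ : Store) :
    ∀ i : Fin n, (rankCode.run p σ).arr 2 0 (rank (fun i => (p i).1) i) = i ∧
      (rankCode.run p σ).arr 3 0 (rank (fun i => (p i).1) i) = rank (fun i => (p i).2) i := by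
  set f : Fin n → ℝ := fun i => (p i).1 with hf
  set g : Fin n → ℝ := fun i => (p i).2 with hg
  refine fun i => Code.loop_rule (fun k (τ : Store) => ∀ i : Fin n, (i : ℕ) < k →
    τ.arr 2 0 (rank f i) = i ∧ τ.arr 3 0 (rank f i) = rank g i) (fun i hi => by omega) ?_
    (fun τ v h => h) i i.2
  intro k hk τ hτ
  simp only [Code.run]
  generalize hτ1 : ((τ.setVar 0 k).setVar 3 _).setVar 4 _ = τ1
  generalize hτ2 : Store.setVar (rounds _ _ _ _) _ _ = τ2
  have key : τ2.arr = τ.arr ∧ τ2.var 0 = k ∧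
      τ2.var 3 = partialRank f ⟨k, hk⟩ n ∧ τ2.var 4 = partialRank g ⟨k, hk⟩ n := by
    rw [← hτ2]
    refine Code.loop_rule (p := p) (x := 1) (c := .seq
        (.ite (.xlt (.var 1) (.var 0)) (.set 3 (.succ (.var 3))) .skip)
        (.ite (.ylt (.var 1) (.var 0)) (.set 4 (.succ (.var 4))) .skip))
      (fun m (ρ : Store) => ρ.arr = τ.arr ∧ ρ.var 0 = k ∧
        ρ.var 3 = partialRank f ⟨k, hk⟩ m ∧ ρ.var 4 = partialRank g ⟨k, hk⟩ m) ?_ ?_ ?_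
    · rw [← hτ1]
      simp [partialRank_zero, Store.setVar, Rhs.val, Opd.val]
    · rintro m hm ρ ⟨h1, h2, h3, h4⟩
      have hx := partialRank_succ f ⟨k, hk⟩ hm
      have hy := partialRank_succ g ⟨k, hk⟩ hm
      have hxl := partialRank_le f ⟨k, hk⟩ m
      have hyl := partialRank_le g ⟨k, hk⟩ m
      by_cases hfx : f ⟨m, hm⟩ < f ⟨k, hk⟩ <;> by_cases hgx : g ⟨m, hm⟩ < g ⟨k, hk⟩ <;>
        simp only [hfx, hgx, if_true, if_false] at hx hy <;>
        simp [Code.run, Cond.holds, Opd.val, Rhs.val, Store.setVar, h2, idxLT_iff _ hm hk, ← hf,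
          ← hg, hfx, hgx, h1, h3, h4, hx, hy, hxl, hyl]
    · rintro ρ v ⟨h1, h2, h3, h4⟩
      simp [Store.setVar, *]
  obtain ⟨h1, h2, h3, h4⟩ := key
  rw [partialRank_self] at h3 h4
  intro i hi
  by_cases hik : (i : ℕ) = k
  · obtain rfl : i = ⟨k, hk⟩ := Fin.ext hik
    simp [Store.setArr, Opd.val, h2, h3, h4]
  -- Distinct points have distinct ranks, so earlier entries are not overwritten.
  · have hne : rank f i ≠ rank f ⟨k, hk⟩ := fun h => hik (by
      have := rank_injective hp.1 h
      rw [this])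
    have := hτ i (by omega)
    simp [Store.setArr, Opd.val, h2, h3, h4, hne, h1, this]

/-! ### The table -/

/-- The array that holds the table for the flags `a` and `b`. -/
def tbl : Bool → Bool → Fin 8
  | false, false => 4
  | false, true => 5
  | true, false => 6
  | true, true => 7

/-- Replaces the entry of the array `k` at the indices in the variables `1` and `2` by the maximum
with the successor of an entry of the array `k'`. -/
def relax (k k' : Fin 8) (i j : Opd) : Code :=
  .seq (.set 9 (.get k (.var 1) (.var 2))) <| .seq (.set 10 (.get k' i j)) <|
    .seq (.set 10 (.succ (.var 10))) <|
    .ite (.lt (.var 9) (.var 10)) (.put k (.var 1) (.var 2) (.var 10)) .skip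

theorem relax_arr {n : ℕ} (p : Fin n → ℝ × ℝ) (σ : Store) (k k' : Fin 8) {x y : Fin 32}
    (hx : x ≠ 9) (hy : y ≠ 9) (k₀ : Fin 8) (i₀ j₀ : ℕ) :
    ((relax k k' (.var x) (.var y)).run p σ).arr k₀ i₀ j₀ =
      if k₀ = k ∧ i₀ = σ.var 1 ∧ j₀ = σ.var 2 then max (σ.arr k (σ.var 1) (σ.var 2))
        (min (σ.arr k' (σ.var x) (σ.var y) + 1) (n + 1)) else σ.arr k₀ i₀ j₀ := by
  simp only [relax, Code.run, Cond.holds, Opd.val, Rhs.val, Store.setVar, Store.setArr]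
  simp only [hx, hy, if_false, if_true, Fin.reduceEq]
  by_cases hlt : σ.arr k (σ.var 1) (σ.var 2) < min (σ.arr k' (σ.var x) (σ.var y) + 1) (n + 1)
  · rw [if_pos hlt, max_eq_right hlt.le]
  · rw [if_neg hlt, max_eq_left (not_lt.1 hlt)]
    split_ifs with h0
    · obtain ⟨rfl, rfl, rfl⟩ := h0; rfl
    · rfl

theorem relax_var {n : ℕ} (p : Fin n → ℝ × ℝ) (σ : Store) (k k' : Fin 8) (i j : Opd) {x : Fin 32}
    (hx : x ≠ 9) (hx' : x ≠ 10) : ((relax k k' i j).run p σ).var x = σ.var x :=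
  Code.run_keeps p (by simp [relax, Code.keeps, hx.symm, hx'.symm]) σ

theorem Code.run_ite_pos {n : ℕ} {p : Fin n → ℝ × ℝ} {s : Cond} {c d : Code} {σ : Store}
    (h : s.holds p σ) : (Code.ite s c d).run p σ = c.run p σ := by
  rw [run, if_pos h]

theorem Code.run_ite_neg {n : ℕ} {p : Fin n → ℝ × ℝ} {s : Cond} {c d : Code} {σ : Store}
    (h : ¬ s.holds p σ) : (Code.ite s c d).run p σ = d.run p σ := by
  rw [run, if_neg h]

/-- The update of the table entries at the indices in the variables `1` and `2` by the point whose
index is in the variable `5`; the ordinates of these points are in the variables `7`, `8`, `6`. -/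
def updateBranch : Code :=
  .ite (.lt (.var 6) (.var 7))
    (.seq (relax 4 4 (.var 5) (.var 2)) <| .seq (relax 4 5 (.var 5) (.var 2)) <|
      .seq (relax 6 6 (.var 5) (.var 2)) (relax 6 7 (.var 5) (.var 2)))
    (.ite (.lt (.var 8) (.var 6))
      (.seq (relax 4 4 (.var 1) (.var 5)) <| .seq (relax 4 6 (.var 1) (.var 5)) <|
        .seq (relax 5 5 (.var 1) (.var 5)) (relax 5 7 (.var 1) (.var 5)))
      (.seq (.put 4 (.var 1) (.var 2) .zero) <| .seq (.put 5 (.var 1) (.var 2) .zero) <|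
        .seq (.put 6 (.var 1) (.var 2) .zero) <| .seq (.put 7 (.var 1) (.var 2) .zero) <|
        .seq (relax 6 6 (.var 1) (.var 5)) <| .seq (relax 7 7 (.var 1) (.var 5)) <|
        .seq (relax 5 5 (.var 5) (.var 2)) (relax 7 7 (.var 5) (.var 2))))

def updateCode : Code :=
  .seq (.set 6 (.get 3 .zero (.var 5))) <| .seq (.set 7 (.get 3 .zero (.var 1))) <|
  .seq (.set 8 (.get 3 .zero (.var 2))) updateBranch

theorem updateBranch_spec {n : ℕ} (p : Fin n → ℝ × ℝ) {Y : ℕ → ℕ} (τ : Store) {e lo hi : ℕ}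
    (hen : e < n) (hlo : lo < e) (hhi : hi < e) (e5 : τ.var 5 = e) (e1 : τ.var 1 = lo)
    (e2 : τ.var 2 = hi) (e6 : τ.var 6 = Y e) (e7 : τ.var 7 = Y lo) (e8 : τ.var 8 = Y hi)
    (hT1 : ∀ a b, τ.arr (tbl a b) e hi = gain n Y (e + 1) a b e hi)
    (hT2 : ∀ a b, τ.arr (tbl a b) lo e = gain n Y (e + 1) a b lo e)
    (hT : ∀ a b, τ.arr (tbl a b) lo hi = gain n Y (e + 1) a b lo hi) :
    (∀ a b, (updateBranch.run p τ).arr (tbl a b) lo hi = gain n Y e a b lo hi) ∧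
    ∀ k i j, ¬ (i = lo ∧ j = hi) → (updateBranch.run p τ).arr k i j = τ.arr k i j := by
  have hne1 : e ≠ lo := by omega
  have hne2 : e ≠ hi := by omega
  -- A gain is at most `n`, so the truncation in the successor never takes effect.
  have hb1 : ∀ a b, τ.arr (tbl a b) e hi ≤ n := fun a b => by
    rw [hT1]; exact (gain_le _ _ _ _ _ _ _).trans (by omega)
  have hb2 : ∀ a b, τ.arr (tbl a b) lo e ≤ n := fun a b => by
    rw [hT2]; exact (gain_le _ _ _ _ _ _ _).trans (by omega)
  simp only [gain_of_lt hen, ← hT, ← hT1, ← hT2]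
  clear hT hT1 hT2
  simp only [Bool.forall_bool, tbl] at hb1 hb2 ⊢
  rw [updateBranch]
  by_cases c1 : Y e < Y lo
  · rw [Code.run_ite_pos (by rwa [Cond.holds, Opd.val, Opd.val, e6, e7])]
    simp [Code.run, relax_arr, relax_var, e5, e1, e2, hne1, hb1, c1]
    grind
  rw [Code.run_ite_neg (by rwa [Cond.holds, Opd.val, Opd.val, e6, e7])]
  by_cases c2 : Y hi < Y e
  · rw [Code.run_ite_pos (by rwa [Cond.holds, Opd.val, Opd.val, e6, e8])]
    simp [Code.run, relax_arr, relax_var, e5, e1, e2, hne2, hb2, c1, c2]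
    grind
  · rw [Code.run_ite_neg (by rwa [Cond.holds, Opd.val, Opd.val, e6, e8])]
    simp [Code.run, relax_arr, relax_var, Store.setArr, Opd.val, e5, e1, e2, hne1, hne2, hb1,
      hb2, c1, c2]
    grind

theorem updateCode_spec {n : ℕ} (p : Fin n → ℝ × ℝ) (σ : Store) {e lo hi : ℕ} (hen : e < n)
    (hlo : lo < e) (hhi : hi < e) (h5 : σ.var 5 = e) (h1 : σ.var 1 = lo) (h2 : σ.var 2 = hi)
    (hT1 : ∀ a b, σ.arr (tbl a b) e hi = gain n (σ.arr 3 0) (e + 1) a b e hi)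
    (hT2 : ∀ a b, σ.arr (tbl a b) lo e = gain n (σ.arr 3 0) (e + 1) a b lo e)
    (hT : ∀ a b, σ.arr (tbl a b) lo hi = gain n (σ.arr 3 0) (e + 1) a b lo hi) :
    (∀ a b, (updateCode.run p σ).arr (tbl a b) lo hi = gain n (σ.arr 3 0) e a b lo hi) ∧
    ∀ k i j, ¬ (i = lo ∧ j = hi) → (updateCode.run p σ).arr k i j = σ.arr k i j := by
  simp only [updateCode, Code.run]
  exact updateBranch_spec p _ hen hlo hhi (by simp [Store.setVar, h5]) (by simp [Store.setVar, h1])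
    (by simp [Store.setVar, h2]) (by simp [Store.setVar, Rhs.val, Opd.val, h5])
    (by simp [Store.setVar, Rhs.val, Opd.val, h1]) (by simp [Store.setVar, Rhs.val, Opd.val, h2])
    hT1 hT2 hT

/-- The sweep position in variable 5 runs from `n - 1` down to 0, and one table is overwritten in
place. -/
def tableCode : Code :=
  .loop 0 <| .seq (.set 5 (.sub .size (.var 0))) <| .seq (.set 5 (.sub (.var 5) .one)) <|
    .loop 1 <| .loop 2 <| .ite (.lt (.var 1) (.var 5)) (.ite (.lt (.var 2) (.var 5)) updateCode .skip)
      .skip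

theorem tableCode_spec {n : ℕ} (p : Fin n → ℝ × ℝ) (σ : Store)
    (h : ∀ a b lo hi, σ.arr (tbl a b) lo hi = 0) :
    ∀ a b lo hi, lo < n → hi < n → (tableCode.run p σ).arr (tbl a b) lo hi =
      gain n (σ.arr 3 0) (max lo hi + 1) a b lo hi := by
  set Y := σ.arr 3 0 with hY
  have key : (tableCode.run p σ).arr 3 = σ.arr 3 ∧ ∀ a b lo hi, lo < n → hi < n →
      (tableCode.run p σ).arr (tbl a b) lo hi =
        gain n Y (max (n - n) (max lo hi + 1)) a b lo hi := by
    -- After `k` rounds an entry is at stage `n - k`, but never at a stage below the one just after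
    -- its larger index; from there on it is frozen.
    refine Code.loop_rule (fun k τ => τ.arr 3 = σ.arr 3 ∧ ∀ a b lo hi, lo < n → hi < n →
      τ.arr (tbl a b) lo hi = gain n Y (max (n - k) (max lo hi + 1)) a b lo hi) ?_ ?_
      (fun τ v h => h)
    · refine ⟨rfl, fun a b lo hi hlo hhi => ?_⟩
      rw [h, gain_of_le (by omega)]
    rintro k hk τ ⟨h3, hτ⟩
    obtain ⟨e, he⟩ : ∃ e, e = n - k - 1 := ⟨_, rfl⟩
    have hen : e < n := by omega
    rw [show n - k = e + 1 by omega] at hτ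
    rw [show n - (k + 1) = e by omega]
    -- Progress within stage `e`: entries lexicographically before `(L, H)` with both indices below
    -- `e` have been updated. Entries with an index equal to `e`, which the update reads, stay at
    -- stage `e + 1`, so the order of updates is immaterial.
    let D (L H : ℕ) (ρ : Store) : Prop := ρ.arr 3 = σ.arr 3 ∧ ρ.var 5 = e ∧
      ∀ a b lo hi, lo < n → hi < n → ρ.arr (tbl a b) lo hi =
        if lo < e ∧ hi < e ∧ (lo < L ∨ lo = L ∧ hi < H) then gain n Y e a b lo hi
        else gain n Y (max (e + 1) (max lo hi + 1)) a b lo hi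
    rw [Code.run, Code.run]
    have hD : D n 0 (Code.run p (.loop 1 <| .loop 2 <| .ite (.lt (.var 1) (.var 5))
        (.ite (.lt (.var 2) (.var 5)) updateCode .skip) .skip)
        ((Code.set 5 (.sub (.var 5) .one)).run p
          ((Code.set 5 (.sub .size (.var 0))).run p (τ.setVar 0 k)))) := by
      refine Code.loop_rule (fun L ρ => D L 0 ρ) ⟨h3, ?_, fun a b lo hi hlo hhi => ?_⟩ ?_
        (fun ρ v h => ?_)
      · simp [Code.run, Store.setVar, Rhs.val, Opd.val, he]
      · rw [if_neg (by omega)]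
        exact hτ a b lo hi hlo hhi
      · intro L hL ρ hρ
        have hD' : D L n _ ∧ _ = L := Code.loop_rule (p := p) (x := 2)
          (c := .ite (.lt (.var 1) (.var 5)) (.ite (.lt (.var 2) (.var 5)) updateCode .skip) .skip)
          (σ := ρ.setVar 1 L)
          (fun H ρ => D L H ρ ∧ ρ.var 1 = L) ?_ ?_ ?_
        · obtain ⟨⟨g1, g2, g3⟩, -⟩ := hD'
          refine ⟨g1, g2, fun a b lo hi hlo hhi => ?_⟩
          rw [g3 a b lo hi hlo hhi]
          congr 1
          simp only [eq_iff_iff]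
          omega
        · exact ⟨⟨hρ.1, by rw [Store.setVar_ne _ _ (by decide)]; exact hρ.2.1, hρ.2.2⟩, by simp⟩
        · rintro H hH ρ ⟨⟨g1, g2, g3⟩, g4⟩
          have f1 : (ρ.setVar 2 H).var 1 = L := by rw [Store.setVar_ne _ _ (by decide), g4]
          have f2 : (ρ.setVar 2 H).var 2 = H := by simp
          have f5 : (ρ.setVar 2 H).var 5 = e := by rw [Store.setVar_ne _ _ (by decide), g2]
          have skip : ¬ (L < e ∧ H < e) → D L (H + 1) (ρ.setVar 2 H) ∧ (ρ.setVar 2 H).var 1 = L := by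
            refine fun hn => ⟨⟨g1, f5, fun a b lo hi hlo hhi => ?_⟩, f1⟩
            rw [Store.setVar_arr, g3 a b lo hi hlo hhi]
            congr 1
            simp only [eq_iff_iff]
            omega
          by_cases c1 : L < e
          · rw [Code.run_ite_pos (by rwa [Cond.holds, Opd.val, Opd.val, f1, f5])]
            by_cases c2 : H < e
            · rw [Code.run_ite_pos (by rwa [Cond.holds, Opd.val, Opd.val, f2, f5])]
              have hY3 : (ρ.setVar 2 H).arr 3 0 = Y := by rw [Store.setVar_arr, g1]
              obtain ⟨u1, u2⟩ := updateCode_spec p (ρ.setVar 2 H) hen c1 c2 f5 f1 f2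
                (fun a b => by
                  rw [hY3, Store.setVar_arr, g3 a b e H hen hH, if_neg (by omega)]
                  congr 1; omega)
                (fun a b => by
                  rw [hY3, Store.setVar_arr, g3 a b L e hL hen, if_neg (by omega)]
                  congr 1; omega)
                (fun a b => by
                  rw [hY3, Store.setVar_arr, g3 a b L H hL hH, if_neg (by omega)]
                  congr 1; omega)
              rw [hY3] at u1
              refine ⟨⟨?_, ?_, fun a b lo hi hlo hhi => ?_⟩, ?_⟩
              · rw [Code.run_keepsArr p (by decide)]; exact g1
              · rw [Code.run_keeps p (by decide)]; exact f5
              · by_cases hc : lo = L ∧ hi = H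
                · obtain ⟨rfl, rfl⟩ := hc
                  rw [u1, if_pos (by omega)]
                · rw [u2 _ _ _ hc, Store.setVar_arr, g3 a b lo hi hlo hhi]
                  congr 1
                  simp only [eq_iff_iff]
                  omega
              · rw [Code.run_keeps p (by decide)]; exact f1
            · rw [Code.run_ite_neg (by rwa [Cond.holds, Opd.val, Opd.val, f2, f5])]
              exact skip (by omega)
          · rw [Code.run_ite_neg (by rwa [Cond.holds, Opd.val, Opd.val, f1, f5])]
            exact skip (by omega)
        · rintro ρ v ⟨⟨g1, g2, g3⟩, g4⟩
          exact ⟨⟨g1, by rw [Store.setVar_ne _ _ (by decide), g2], g3⟩,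
            by rw [Store.setVar_ne _ _ (by decide), g4]⟩
      · exact ⟨h.1, by rw [Store.setVar_ne _ _ (by decide), h.2.1], h.2.2⟩
    refine ⟨hD.1, fun a b lo hi hlo hhi => ?_⟩
    refine (hD.2.2 a b lo hi hlo hhi).trans ?_
    split_ifs with hc
    · congr 1; omega
    · congr 1; omega
  intro a b lo hi hlo hhi
  rw [key.2 a b lo hi hlo hhi]
  congr 1
  omega

/-! ### The optimal initial state -/

def bitOpd (b : Bool) : Opd := if b then .one else .zero

theorem bitOpd_val (n : ℕ) (σ : Store) (b : Bool) : (bitOpd b).val n σ = b.toNat := by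
  cases b <;> rfl

def startBranch (a b : Bool) : Code :=
  .ite (.lt (.var 11) (.var 9))
    (.seq (.set 11 (.opd (.var 9))) <| .seq (.set 12 (.opd (.var 1))) <|
      .seq (.set 13 (.opd (bitOpd a))) (.set 14 (.opd (bitOpd b)))) .skip

def tryStart (a b : Bool) : Code :=
  .seq (.set 9 (.get (tbl a b) (.var 1) (.var 1))) <| .seq (.set 9 (.succ (.var 9)))
    (startBranch a b)

def startCode : Code :=
  .seq (.set 11 (.opd .zero)) <| .loop 1 <| .seq (tryStart false false) <|
    .seq (tryStart false true) <| .seq (tryStart true false) (tryStart true true)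

/-- The variables `11` to `14` hold the maximum of `V + 1` over the initial states in `C`, and an
initial state for which it is attained. -/
def IsBest (n : ℕ) (V : ℕ → Bool → Bool → ℕ) (C : ℕ → Bool → Bool → Prop) (σ : Store) : Prop :=
  (∀ l a b, C l a b → V l a b + 1 ≤ σ.var 11) ∧
    (σ.var 11 = 0 ∨ ∃ l a b, l < n ∧ σ.var 12 = l ∧ σ.var 13 = Bool.toNat a ∧
      σ.var 14 = Bool.toNat b ∧ σ.var 11 = V l a b + 1)

theorem tryStart_spec {n : ℕ} (p : Fin n → ℝ × ℝ) {V : ℕ → Bool → Bool → ℕ}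
    {C : ℕ → Bool → Bool → Prop} {σ : Store} {l : ℕ} (hl : l < n) (h1 : σ.var 1 = l) (a b : Bool)
    (hV : σ.arr (tbl a b) l l = V l a b) (hVn : V l a b ≤ n) (h : IsBest n V C σ) :
    IsBest n V (fun l' a' b' => C l' a' b' ∨ l' = l ∧ a' = a ∧ b' = b)
      ((tryStart a b).run p σ) := by
  simp only [tryStart, Code.run]
  generalize hτ : (σ.setVar 9 _).setVar 9 _ = τ
  have e9 : τ.var 9 = V l a b + 1 := by
    rw [← hτ]
    simp [Store.setVar, Rhs.val, Opd.val, h1, hV, hVn]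
  have e1 : τ.var 1 = l := by simp [← hτ, Store.setVar, h1]
  have h' : IsBest n V C τ := by simpa [← hτ, IsBest, Store.setVar] using h
  clear hτ
  rw [startBranch]
  by_cases hlt : τ.var 11 < τ.var 9
  · rw [Code.run_ite_pos (s := .lt (.var 11) (.var 9)) hlt]
    simp only [IsBest, Code.run, Rhs.val, bitOpd_val]
    simp only [Opd.val]
    refine ⟨?_, Or.inr ⟨l, a, b, hl, by simp [Store.setVar, e1], by simp [Store.setVar],
      by simp [Store.setVar], by simp [Store.setVar, e9]⟩⟩
    rintro l' a' b' (hC | ⟨rfl, rfl, rfl⟩)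
    · have := h'.1 l' a' b' hC
      simp only [Store.setVar, Fin.reduceEq, if_false, if_true]
      omega
    · simp [Store.setVar, e9]
  · rw [Code.run_ite_neg (s := .lt (.var 11) (.var 9)) hlt, Code.run]
    refine ⟨?_, h'.2⟩
    rintro l' a' b' (hC | ⟨rfl, rfl, rfl⟩)
    · exact h'.1 l' a' b' hC
    · omega

theorem startCode_arr {n : ℕ} (p : Fin n → ℝ × ℝ) (σ : Store) :
    (startCode.run p σ).arr = σ.arr := by
  funext k
  exact Code.run_keepsArr p (by revert k; decide) σ

theorem tryStart_arr {n : ℕ} (p : Fin n → ℝ × ℝ) (a b : Bool) (σ : Store) :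
    ((tryStart a b).run p σ).arr = σ.arr := by
  funext k
  exact Code.run_keepsArr p (by revert a b k; decide) σ

theorem tryStart_var {n : ℕ} (p : Fin n → ℝ × ℝ) (a b : Bool) (σ : Store) :
    ((tryStart a b).run p σ).var 1 = σ.var 1 :=
  Code.run_keeps p (by revert a b; decide) σ

theorem startCode_spec {n : ℕ} (p : Fin n → ℝ × ℝ) {V : ℕ → Bool → Bool → ℕ} (σ : Store)
    (hV : ∀ l a b, l < n → σ.arr (tbl a b) l l = V l a b) (hVn : ∀ l a b, V l a b ≤ n) :
    IsBest n V (fun l _ _ => l < n) (startCode.run p σ) := by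
  refine (Code.loop_rule (p := p) (x := 1) (c := .seq (tryStart false false) <|
    .seq (tryStart false true) <| .seq (tryStart true false) (tryStart true true))
    (σ := (Code.set 11 (.opd .zero)).run p σ)
    (fun k τ => IsBest n V (fun l _ _ => l < k) τ ∧ τ.arr = σ.arr) ⟨⟨by simp, Or.inl ?_⟩, rfl⟩ ?_
    (fun τ v h => ⟨by simpa [IsBest, Store.setVar] using h.1, h.2⟩)).1
  · simp [Code.run, Store.setVar, Rhs.val, Opd.val]
  · rintro k hk τ ⟨h1, h2⟩
    simp only [Code.run]
    refine ⟨?_, by simp only [tryStart_arr, Store.setVar_arr, h2]⟩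
    have h0 : IsBest n V (fun l _ _ => l < k) (τ.setVar 1 k) := by
      simpa [IsBest, Store.setVar] using h1
    have hh := fun {C : ℕ → Bool → Bool → Prop} {ρ : Store} (ha : ρ.arr = σ.arr)
      (h1 : ρ.var 1 = k) (a b : Bool) (h : IsBest n V C ρ) =>
      tryStart_spec p hk h1 a b (by rw [ha]; exact hV k a b hk) (hVn k a b) h
    have s := hh (by simp only [tryStart_arr, Store.setVar_arr, h2])
      (by simp only [tryStart_var, Store.setVar_self]) true true <|
      hh (by simp only [tryStart_arr, Store.setVar_arr, h2])
      (by simp only [tryStart_var, Store.setVar_self]) true false <|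
      hh (by simp only [tryStart_arr, Store.setVar_arr, h2])
      (by simp only [tryStart_var, Store.setVar_self]) false true <|
      hh (by simp only [Store.setVar_arr, h2])
      (by simp only [Store.setVar_self]) false false h0
    refine ⟨fun l a b hl => s.1 l a b ?_, s.2⟩
    by_cases hlk : l = k
    · cases a <;> cases b <;> simp [hlk]
    · have : l < k := by omega
      simp [this]

/-! ### Reconstruction of an optimal set -/

def markCode (x : Fin 32) : Code :=
  .seq (.set 20 (.get 2 .zero (.var x))) (.put 1 .zero (.var 20) .one)

def lowBranch (b : Bool) (c : Code) : Code :=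
  .ite (.eq (.var 20) (.var 19))
    (.seq (.set 19 (.sub (.var 19) .one)) <| .seq (.set 18 (.opd (bitOpd b))) <|
      .seq (.set 15 (.opd (.var 0))) (markCode 0)) c

/-- If the table says so, the point with index in the variable `0` becomes the lower point with
flag `b`, otherwise `c` is run. -/
def lowAttempt (b : Bool) (c : Code) : Code :=
  .seq (.ite (.eq (.var 17) .zero) (.set 20 (.get (tbl false b) (.var 0) (.var 16)))
    (.set 20 (.get (tbl true b) (.var 0) (.var 16)))) <|
  .seq (.set 20 (.succ (.var 20))) (lowBranch b c)

def highBranch (a : Bool) (c : Code) : Code :=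
  .ite (.eq (.var 20) (.var 19))
    (.seq (.set 19 (.sub (.var 19) .one)) <| .seq (.set 17 (.opd (bitOpd a))) <|
      .seq (.set 16 (.opd (.var 0))) (markCode 0)) c

/-- If the table says so, the point with index in the variable `0` becomes the upper point with
flag `a`, otherwise `c` is run. -/
def highAttempt (a : Bool) (c : Code) : Code :=
  .seq (.ite (.eq (.var 18) .zero) (.set 20 (.get (tbl a false) (.var 15) (.var 0)))
    (.set 20 (.get (tbl a true) (.var 15) (.var 0)))) <|
  .seq (.set 20 (.succ (.var 20))) (highBranch a c)

/-- The floor alternative for a point inside the band. If it fails too, nothing happens; this is the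
dead end of the recursion. -/
def restCode : Code := .ite (.eq (.var 18) .one) (lowAttempt true .skip) .skip

def stepBranch : Code :=
  .ite (.lt (.var 6) (.var 7))
    (.ite (.eq (.var 18) .zero) (lowAttempt false (lowAttempt true .skip)) .skip) <|
  .ite (.lt (.var 8) (.var 6))
    (.ite (.eq (.var 17) .zero) (highAttempt false (highAttempt true .skip)) .skip) <|
  .ite (.eq (.var 17) .one) (highAttempt true restCode) restCode

def stepCode : Code :=
  .seq (.set 6 (.get 3 .zero (.var 0))) <| .seq (.set 7 (.get 3 .zero (.var 15))) <|
    .seq (.set 8 (.get 3 .zero (.var 16))) stepBranch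

/-- Variables 15 to 18 hold the state `lo`, `hi`, `a`, `b`, and variable 19 the number of points
still to be found. It starts one below the optimum because the initial point is marked at once. -/
def pathCode : Code :=
  .seq (.set 15 (.opd (.var 12))) <| .seq (.set 16 (.opd (.var 12))) <|
  .seq (.set 17 (.opd (.var 13))) <| .seq (.set 18 (.opd (.var 14))) <|
  .seq (.set 19 (.sub (.var 11) .one)) <| .seq (markCode 12) <|
  .loop 0 <| .ite (.lt (.var 12) (.var 0)) stepCode .skip

/-- The store during the reconstruction: the current state is `a b lo hi`, the set `Q` has been
marked, and `v` points remain to be found. -/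
structure Tracing (n : ℕ) (Y ord : ℕ → ℕ) (l : ℕ) (a b : Bool) (lo hi v : ℕ) (Q : Finset ℕ)
    (σ : Store) : Prop where
  var12 : σ.var 12 = l
  var15 : σ.var 15 = lo
  var16 : σ.var 16 = hi
  var17 : σ.var 17 = a.toNat
  var18 : σ.var 18 = b.toNat
  var19 : σ.var 19 = v
  marks : ∀ k < n, σ.arr 1 0 (ord k) = if k ∈ Q then 1 else 0
  ords : σ.arr 2 0 = ord
  ys : σ.arr 3 0 = Y
  table : ∀ a b lo hi, lo < n → hi < n →
    σ.arr (tbl a b) lo hi = gain n Y (max lo hi + 1) a b lo hi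

namespace Tracing

variable {n : ℕ} {p : Fin n → ℝ × ℝ} {Y ord : ℕ → ℕ} {l : ℕ} {a b : Bool} {lo hi v e : ℕ}
  {Q : Finset ℕ} {σ : Store}

theorem setVar (h : Tracing n Y ord l a b lo hi v Q σ) {x : Fin 32} (w : ℕ)
    (hx : x = 0 ∨ x = 6 ∨ x = 7 ∨ x = 8 ∨ x = 20) :
    Tracing n Y ord l a b lo hi v Q (σ.setVar x w) := by
  have ne : ∀ y : Fin 32, (y = 12 ∨ y = 15 ∨ y = 16 ∨ y = 17 ∨ y = 18 ∨ y = 19) → y ≠ x := by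
    rintro y hy rfl
    revert y; decide
  obtain ⟨h1, h2, h3, h4, h5, h6, h7, h8, h9, h10⟩ := h
  exact ⟨by rwa [Store.setVar_ne _ _ (ne _ (by simp))], by rwa [Store.setVar_ne _ _ (ne _ (by simp))],
    by rwa [Store.setVar_ne _ _ (ne _ (by simp))], by rwa [Store.setVar_ne _ _ (ne _ (by simp))],
    by rwa [Store.setVar_ne _ _ (ne _ (by simp))], by rwa [Store.setVar_ne _ _ (ne _ (by simp))],
    h7, h8, h9, h10⟩

theorem mark (hinj : Set.InjOn ord (Set.Iio n)) (h : Tracing n Y ord l a b lo hi v Q σ)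
    {x : Fin 32} (he : σ.var x = e) (hen : e < n) :
    Tracing n Y ord l a b lo hi v (insert e Q) ((markCode x).run p σ) := by
  have h' := h.setVar (σ.arr 2 0 (σ.var x)) (x := 20) (by simp)
  have e20 : σ.arr 2 0 (σ.var x) = ord e := by rw [h.ords, he]
  simp only [markCode, Code.run, Rhs.val, Opd.val]
  obtain ⟨h1, h2, h3, h4, h5, h6, h7, h8, h9, h10⟩ := h'
  refine ⟨h1, h2, h3, h4, h5, h6, fun k hk => ?_, ?_, ?_, fun a b lo hi hlo hhi => ?_⟩
  · simp only [Store.setArr, Store.setVar_self, e20, true_and]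
    by_cases hke : k = e
    · simp [hke]
    · have : ord k ≠ ord e := fun h => hke (hinj hk hen h)
      simp [hke, this, h.marks k hk]
  · exact h8
  · exact h9
  · rw [← h10 a b lo hi hlo hhi]
    cases a <;> cases b <;> rfl

/-- The entry read has `e` as its larger index, so it is the gain at stage `e + 1`. Taking `e` is
optimal exactly when this gain plus one equals the number `v` still to be found. The arbitrary
`Post` allows attempts to be chained. -/
theorem lowAttempt (hinj : Set.InjOn ord (Set.Iio n)) (h : Tracing n Y ord l a b lo hi v Q σ)
    (he : σ.var 0 = e) (hen : e < n) (hhi : hi < e) {b' : Bool} {c : Code} {Post : Store → Prop}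
    (h1 : gain n Y (e + 1) a b' e hi + 1 = v → ∀ ρ,
      Tracing n Y ord l a b' e hi (v - 1) (insert e Q) ρ → Post ρ)
    (h2 : gain n Y (e + 1) a b' e hi + 1 ≠ v → ∀ ρ,
      Tracing n Y ord l a b lo hi v Q ρ → ρ.var 0 = e → Post (c.run p ρ)) :
    Post ((lowAttempt b' c).run p σ) := by
  have hle : gain n Y (e + 1) a b' e hi ≤ n := (gain_le _ _ _ _ _ _ _).trans (by omega)
  have ht : σ.arr (tbl a b') e hi = gain n Y (e + 1) a b' e hi := by
    rw [h.table a b' e hi hen (by omega)]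
    congr 1; omega
  have hget : (Code.ite (.eq (.var 17) .zero) (.set 20 (.get (tbl false b') (.var 0) (.var 16)))
      (.set 20 (.get (tbl true b') (.var 0) (.var 16)))).run p σ =
      σ.setVar 20 (gain n Y (e + 1) a b' e hi) := by
    cases a
    · rw [Code.run_ite_pos (by simp [Cond.holds, Opd.val, h.var17]), Code.run, Rhs.val, Opd.val,
        Opd.val, he, h.var16, ht]
    · rw [Code.run_ite_neg (by simp [Cond.holds, Opd.val, h.var17]), Code.run, Rhs.val, Opd.val,
        Opd.val, he, h.var16, ht]
  rw [RectHull.lowAttempt, Code.run, Code.run, hget, Code.run, Rhs.val, Opd.val, Store.setVar_self,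
    Store.setVar_setVar, min_eq_left (by omega)]
  have h' := h.setVar (gain n Y (e + 1) a b' e hi + 1) (x := 20) (by simp)
  have he' : (σ.setVar 20 (gain n Y (e + 1) a b' e hi + 1)).var 0 = e := by
    rw [Store.setVar_ne _ _ (by decide), he]
  rw [lowBranch]
  by_cases hv : gain n Y (e + 1) a b' e hi + 1 = v
  · rw [Code.run_ite_pos (by rw [Cond.holds, Opd.val, Opd.val, h'.var19]; simpa using hv)]
    refine h1 hv _ ?_
    simp only [Code.run, Rhs.val, bitOpd_val]
    simp only [Opd.val]
    generalize σ.setVar 20 _ = ρ at h' he'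
    refine mark hinj (lo := e) ?_ (by simp [Store.setVar, he']) hen
    obtain ⟨g1, g2, g3, g4, g5, g6, g7, g8, g9, g10⟩ := h'
    exact ⟨by simp [Store.setVar, g1], by simp [Store.setVar, he'], by simp [Store.setVar, g3],
      by simp [Store.setVar, g4], by simp [Store.setVar], by simp [Store.setVar, g6], g7, g8, g9,
      g10⟩
  · rw [Code.run_ite_neg (by rw [Cond.holds, Opd.val, Opd.val, h'.var19]; simpa using hv)]
    exact h2 hv _ h' he'

theorem highAttempt (hinj : Set.InjOn ord (Set.Iio n)) (h : Tracing n Y ord l a b lo hi v Q σ)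
    (he : σ.var 0 = e) (hen : e < n) (hlo : lo < e) {a' : Bool} {c : Code} {Post : Store → Prop}
    (h1 : gain n Y (e + 1) a' b lo e + 1 = v → ∀ ρ,
      Tracing n Y ord l a' b lo e (v - 1) (insert e Q) ρ → Post ρ)
    (h2 : gain n Y (e + 1) a' b lo e + 1 ≠ v → ∀ ρ,
      Tracing n Y ord l a b lo hi v Q ρ → ρ.var 0 = e → Post (c.run p ρ)) :
    Post ((highAttempt a' c).run p σ) := by
  have hle : gain n Y (e + 1) a' b lo e ≤ n := (gain_le _ _ _ _ _ _ _).trans (by omega)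
  have ht : σ.arr (tbl a' b) lo e = gain n Y (e + 1) a' b lo e := by
    rw [h.table a' b lo e (by omega) hen]
    congr 1; omega
  have hget : (Code.ite (.eq (.var 18) .zero) (.set 20 (.get (tbl a' false) (.var 15) (.var 0)))
      (.set 20 (.get (tbl a' true) (.var 15) (.var 0)))).run p σ =
      σ.setVar 20 (gain n Y (e + 1) a' b lo e) := by
    cases b
    · rw [Code.run_ite_pos (by simp [Cond.holds, Opd.val, h.var18]), Code.run, Rhs.val, Opd.val,
        Opd.val, he, h.var15, ht]
    · rw [Code.run_ite_neg (by simp [Cond.holds, Opd.val, h.var18]), Code.run, Rhs.val, Opd.val,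
        Opd.val, he, h.var15, ht]
  rw [RectHull.highAttempt, Code.run, Code.run, hget, Code.run, Rhs.val, Opd.val,
    Store.setVar_self, Store.setVar_setVar, min_eq_left (by omega)]
  have h' := h.setVar (gain n Y (e + 1) a' b lo e + 1) (x := 20) (by simp)
  have he' : (σ.setVar 20 (gain n Y (e + 1) a' b lo e + 1)).var 0 = e := by
    rw [Store.setVar_ne _ _ (by decide), he]
  rw [highBranch]
  by_cases hv : gain n Y (e + 1) a' b lo e + 1 = v
  · rw [Code.run_ite_pos (by rw [Cond.holds, Opd.val, Opd.val, h'.var19]; simpa using hv)]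
    refine h1 hv _ ?_
    simp only [Code.run, Rhs.val, bitOpd_val]
    simp only [Opd.val]
    generalize σ.setVar 20 _ = ρ at h' he'
    refine mark hinj (hi := e) ?_ (by simp [Store.setVar, he']) hen
    obtain ⟨g1, g2, g3, g4, g5, g6, g7, g8, g9, g10⟩ := h'
    exact ⟨by simp [Store.setVar, g1], by simp [Store.setVar, g2], by simp [Store.setVar, he'],
      by simp [Store.setVar], by simp [Store.setVar, g5], by simp [Store.setVar, g6], g7, g8, g9,
      g10⟩
  · rw [Code.run_ite_neg (by rw [Cond.holds, Opd.val, Opd.val, h'.var19]; simpa using hv)]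
    exact h2 hv _ h' he'

end Tracing

/-- The invariant of the reconstruction of a set of `m` points. -/
def PathInv (n : ℕ) (Y ord : ℕ → ℕ) (l m E : ℕ) (σ : Store) : Prop :=
  ∃ a b lo hi v Q, Tracing n Y ord l a b lo hi v Q σ ∧ lo < E ∧ hi < E ∧ Q.card + v = m ∧
    (∀ q ∈ Q, q < n) ∧ ((SweepInv n Y E a b lo hi Q ∧ v = gain n Y E a b lo hi) ∨
      (v = 0 ∧ Unsurrounded n Y Q))

section

variable {n : ℕ} (p : Fin n → ℝ × ℝ) {Y ord : ℕ → ℕ} {l m e : ℕ} {σ : Store}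

/-- The number `v` equals the current gain, so one alternative of the recursion attains it; if no
attempt to take `e` does, skipping does, or the sweep has ended with `v = 0`. After such an end, no
attempt can succeed, since each compares a successor with 0. -/
theorem stepBranch_spec (hinj : Set.InjOn ord (Set.Iio n)) {a b : Bool} {lo hi v : ℕ}
    {Q : Finset ℕ} (he : σ.var 0 = e) (hen : e < n) (h : Tracing n Y ord l a b lo hi v Q σ)
    (hlo : lo < e) (hhi : hi < e) (h6 : σ.var 6 = Y e) (h7 : σ.var 7 = Y lo)
    (h8 : σ.var 8 = Y hi) (hm : Q.card + v = m) (hQ : ∀ q ∈ Q, q < n)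
    (hI : (SweepInv n Y e a b lo hi Q ∧ v = gain n Y e a b lo hi) ∨
      (v = 0 ∧ Unsurrounded n Y Q)) :
    PathInv n Y ord l m (e + 1) (stepBranch.run p σ) := by
  have halt : v = 0 → Unsurrounded n Y Q → ∀ ρ, Tracing n Y ord l a b lo hi v Q ρ →
      PathInv n Y ord l m (e + 1) ρ := fun hv hU ρ hρ =>
    ⟨a, b, lo, hi, v, Q, hρ, by omega, by omega, hm, hQ, Or.inr ⟨hv, hU⟩⟩
  have skip : SweepInv n Y (e + 1) a b lo hi Q → v = gain n Y (e + 1) a b lo hi → ∀ ρ,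
      Tracing n Y ord l a b lo hi v Q ρ → PathInv n Y ord l m (e + 1) ρ := fun hS hv ρ hρ =>
    ⟨a, b, lo, hi, v, Q, hρ, by omega, by omega, hm, hQ, Or.inl ⟨hS, hv⟩⟩
  have take : ∀ {a' b' lo' hi'}, gain n Y (e + 1) a' b' lo' hi' + 1 = v → lo' < e + 1 →
      hi' < e + 1 →
      (SweepInv n Y e a b lo hi Q → SweepInv n Y (e + 1) a' b' lo' hi' (insert e Q)) →
      ∀ ρ, Tracing n Y ord l a' b' lo' hi' (v - 1) (insert e Q) ρ →
        PathInv n Y ord l m (e + 1) ρ := by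
    intro a' b' lo' hi' hv h1 h2 hS ρ hρ
    rcases hI with ⟨hI, _⟩ | ⟨hI, _⟩
    · have hnot : e ∉ Q := fun hmem => lt_irrefl e (hI.lt e hmem)
      refine ⟨a', b', lo', hi', v - 1, insert e Q, hρ, h1, h2, ?_, ?_,
        Or.inl ⟨hS hI, by omega⟩⟩
      · rw [Finset.card_insert_of_notMem hnot]; omega
      · intro q hq
        rcases Finset.mem_insert.1 hq with rfl | hq
        exacts [hen, hQ q hq]
    · omega
  have hg := gain_of_lt (Y := Y) hen a b lo hi
  rw [stepBranch]
  by_cases c1 : Y e < Y lo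
  · rw [Code.run_ite_pos (by rwa [Cond.holds, Opd.val, Opd.val, h6, h7])]
    rw [if_pos c1] at hg
    cases hb : b
    · subst hb
      rw [Code.run_ite_pos (by simp [Cond.holds, Opd.val, h.var18])]
      refine h.lowAttempt hinj he hen hhi
        (fun hv => take hv (by omega) (by omega) fun hS => hS.take_below c1 false) ?_
      intro hv1 ρ hρ heρ
      refine hρ.lowAttempt hinj heρ hen hhi
        (fun hv => take hv (by omega) (by omega) fun hS => hS.take_below c1 true) ?_
      intro hv2 ρ hρ heρ
      rcases hI with ⟨hS, hv⟩ | ⟨hv, hU⟩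
      · refine skip (hS.skip_below c1) ?_ _ hρ
        simp only [Bool.false_eq_true, if_false] at hg
        omega
      · exact halt hv hU _ hρ
    · subst hb
      rw [Code.run_ite_neg (by simp [Cond.holds, Opd.val, h.var18])]
      rcases hI with ⟨hS, hv⟩ | ⟨hv, hU⟩
      · exact skip (hS.skip_below c1) (by rw [hv, hg, if_pos rfl]) _ h
      · exact halt hv hU _ h
  rw [Code.run_ite_neg (by rwa [Cond.holds, Opd.val, Opd.val, h6, h7])]
  rw [if_neg c1] at hg
  by_cases c2 : Y hi < Y e
  · rw [Code.run_ite_pos (by rwa [Cond.holds, Opd.val, Opd.val, h6, h8])]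
    rw [if_pos c2] at hg
    cases ha : a
    · subst ha
      rw [Code.run_ite_pos (by simp [Cond.holds, Opd.val, h.var17])]
      refine h.highAttempt hinj he hen hlo
        (fun hv => take hv (by omega) (by omega) fun hS => hS.take_above c2 false) ?_
      intro hv1 ρ hρ heρ
      refine hρ.highAttempt hinj heρ hen hlo
        (fun hv => take hv (by omega) (by omega) fun hS => hS.take_above c2 true) ?_
      intro hv2 ρ hρ heρ
      rcases hI with ⟨hS, hv⟩ | ⟨hv, hU⟩
      · refine skip (hS.skip_above c2) ?_ _ hρ
        simp only [Bool.false_eq_true, if_false] at hg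
        omega
      · exact halt hv hU _ hρ
    · subst ha
      rw [Code.run_ite_neg (by simp [Cond.holds, Opd.val, h.var17])]
      rcases hI with ⟨hS, hv⟩ | ⟨hv, hU⟩
      · exact skip (hS.skip_above c2) (by rw [hv, hg, if_pos rfl]) _ h
      · exact halt hv hU _ h
  rw [Code.run_ite_neg (by rwa [Cond.holds, Opd.val, Opd.val, h6, h8])]
  rw [if_neg c2] at hg
  have rest : (a = true → gain n Y (e + 1) true b lo e + 1 ≠ v) → ∀ ρ,
      Tracing n Y ord l a b lo hi v Q ρ → ρ.var 0 = e →
      PathInv n Y ord l m (e + 1) (restCode.run p ρ) := by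
    intro hv1 ρ hρ heρ
    rw [restCode]
    cases hb : b
    · subst hb
      rw [Code.run_ite_neg (by simp [Cond.holds, Opd.val, hρ.var18])]
      rcases hI with ⟨hS, hv⟩ | ⟨hv, hU⟩
      -- If `a` is true, the cap alternative alone would have attained `v`, contrary to its failure;
      -- so both flags are false and the recursion gives 0.
      · refine halt ?_ hS.unsurrounded _ hρ
        cases a
        · simpa [hv] using hg
        · have := hv1 rfl
          simp at hg
          omega
      · exact halt hv hU _ hρ
    · subst hb
      rw [Code.run_ite_pos (by simp [Cond.holds, Opd.val, hρ.var18])]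
      refine hρ.lowAttempt hinj heρ hen hhi
        (fun hv => take hv (by omega) (by omega) fun hS => hS.floor (by omega) (by omega)) ?_
      intro hv2 ρ hρ heρ
      rcases hI with ⟨hS, hv⟩ | ⟨hv, hU⟩
      · refine halt ?_ hS.unsurrounded _ hρ
        cases a
        · simp at hg
          omega
        · have := hv1 rfl
          simp at hg
          omega
      · exact halt hv hU _ hρ
  cases ha : a
  · subst ha
    rw [Code.run_ite_neg (by simp [Cond.holds, Opd.val, h.var17])]
    exact rest (by simp) σ h he
  · subst ha
    rw [Code.run_ite_pos (by simp [Cond.holds, Opd.val, h.var17])]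
    exact h.highAttempt hinj he hen hlo
      (fun hv => take hv (by omega) (by omega) fun hS => hS.cap (by omega) (by omega))
      (fun hv ρ hρ heρ => rest (fun _ => hv) ρ hρ heρ)

theorem stepCode_spec (hinj : Set.InjOn ord (Set.Iio n)) (he : σ.var 0 = e) (hen : e < n)
    (h : PathInv n Y ord l m e σ) : PathInv n Y ord l m (e + 1) (stepCode.run p σ) := by
  obtain ⟨a, b, lo, hi, v, Q, hT, hlo, hhi, hm, hQ, hI⟩ := h
  simp only [stepCode, Code.run]
  exact stepBranch_spec p hinj (by simp [Store.setVar, he]) hen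
    (((hT.setVar _ (by simp)).setVar _ (by simp)).setVar _ (by simp)) hlo hhi
    (by simp [Store.setVar, Rhs.val, Opd.val, he, hT.ys])
    (by simp [Store.setVar, Rhs.val, Opd.val, hT.var15, hT.ys])
    (by simp [Store.setVar, Rhs.val, Opd.val, hT.var16, hT.ys]) hm hQ hI

theorem pathCode_spec (hinj : Set.InjOn ord (Set.Iio n)) (a b : Bool) (hl : l < n)
    (h11 : σ.var 11 = gain n Y (l + 1) a b l l + 1) (h12 : σ.var 12 = l)
    (h13 : σ.var 13 = a.toNat) (h14 : σ.var 14 = b.toNat) (h1 : ∀ j, σ.arr 1 0 j = 0)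
    (h2 : σ.arr 2 0 = ord) (h3 : σ.arr 3 0 = Y)
    (ht : ∀ a b lo hi, lo < n → hi < n →
      σ.arr (tbl a b) lo hi = gain n Y (max lo hi + 1) a b lo hi) :
    ∃ Q : Finset ℕ, (∀ q ∈ Q, q < n) ∧ Unsurrounded n Y Q ∧
      Q.card = gain n Y (l + 1) a b l l + 1 ∧
      ∀ k < n, (pathCode.run p σ).arr 1 0 (ord k) = if k ∈ Q then 1 else 0 := by
  set m := gain n Y (l + 1) a b l l + 1 with hm
  have key : PathInv n Y ord l m (max n (l + 1)) (pathCode.run p σ) := by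
    simp only [pathCode]
    rw [Code.run, Code.run, Code.run, Code.run, Code.run, Code.run]
    -- The sweep proper starts at `l + 1`; rounds up to `l` change nothing, hence the maximum.
    refine Code.loop_rule (fun k τ => PathInv n Y ord l m (max k (l + 1)) τ) ?_ ?_ ?_
    · refine ⟨a, b, l, l, m - 1, insert l ∅, ?_, by omega, by omega, ?_, ?_, Or.inl ⟨?_, ?_⟩⟩
      · simp only [Code.run, Rhs.val, Opd.val]
        refine Tracing.mark hinj ?_ (by simp [Store.setVar, h12]) hl
        exact ⟨by simp [Store.setVar, h12], by simp [Store.setVar, h12],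
          by simp [Store.setVar, h12], by simp [Store.setVar, h13], by simp [Store.setVar, h14],
          by simp [Store.setVar, h11], by simpa using fun k _ => h1 _, h2, h3, ht⟩
      · simp; omega
      · simpa using hl
      · rw [max_eq_right (by omega)]; exact SweepInv.init l a b
      · rw [max_eq_right (by omega)]; omega
    · intro k hk τ hτ
      have hτ' : PathInv n Y ord l m (max k (l + 1)) (τ.setVar 0 k) := by
        obtain ⟨a, b, lo, hi, v, Q, hT, hr⟩ := hτ
        exact ⟨a, b, lo, hi, v, Q, hT.setVar _ (by simp), hr⟩
      have e12 : (τ.setVar 0 k).var 12 = l := by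
        obtain ⟨_, _, _, _, _, _, hT, _⟩ := hτ'
        exact hT.var12
      by_cases hlk : l < k
      · rw [Code.run_ite_pos (by rw [Cond.holds, Opd.val, Opd.val, e12]; simpa using hlk)]
        rw [max_eq_left (by omega)] at hτ' ⊢
        exact stepCode_spec p hinj (by simp) hk hτ'
      · rw [Code.run_ite_neg (by rw [Cond.holds, Opd.val, Opd.val, e12]; simpa using hlk)]
        rw [max_eq_right (by omega)] at hτ' ⊢
        exact hτ'
    · rintro τ v ⟨a, b, lo, hi, w, Q, hT, hr⟩
      exact ⟨a, b, lo, hi, w, Q, hT.setVar _ (by simp), hr⟩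
  obtain ⟨a', b', lo, hi, v, Q, hT, -, -, hc, hQ, hI⟩ := key
  refine ⟨Q, hQ, ?_, ?_, hT.marks⟩
  · rcases hI with hI | hI
    exacts [hI.1.unsurrounded, hI.2]
  · rcases hI with hI | hI
    · rw [gain_of_le (by omega)] at hI
      omega
    · omega

end

/-! ### The whole algorithm -/

def mainCode : Code := .seq rankCode <| .seq tableCode <| .seq startCode pathCode

def zeroStore : Store := ⟨fun _ => 0, fun _ _ _ => 0⟩

theorem mainCode_spec {n : ℕ} {p : Fin n → ℝ × ℝ} (hp : GeneralPosition p) :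
    ∃ Q : Finset ℕ, IsMaxEmptyRCH (Set.range p) (p '' {i | rank (fun i => (p i).1) i ∈ Q}) ∧
      ∀ i : Fin n, (mainCode.run p zeroStore).arr 1 0 i ≠ 0 ↔ rank (fun i => (p i).1) i ∈ Q := by
  rcases Nat.eq_zero_or_pos n with rfl | hn
  · refine ⟨∅, isMaxEmptyRCH_image (Y := fun _ => 0) hp (fun i => i.elim0) (by simp)
      (fun z hz => by omega) (fun Q' hQ' _ => ?_), fun i => i.elim0⟩
    have : Q' = ∅ := Finset.eq_empty_of_forall_notMem fun q hq => by have := hQ' q hq; omega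
    simp [this]
  set σ₁ := rankCode.run p zeroStore with hσ₁
  set σ₂ := tableCode.run p σ₁ with hσ₂
  set σ₃ := startCode.run p σ₂ with hσ₃
  have hr := rankCode_spec hp zeroStore
  rw [← hσ₁] at hr
  set Y := σ₁.arr 3 0 with hYdef
  set ord := σ₁.arr 2 0 with horddef
  have z1 : ∀ k, (k = 1 ∨ k = 4 ∨ k = 5 ∨ k = 6 ∨ k = 7) → ∀ i j, σ₁.arr k i j = 0 := by
    intro k hk i j
    rw [hσ₁, Code.run_keepsArr p (by revert k; decide)]
    rfl
  have ht := tableCode_spec p σ₁ (fun a b lo hi => z1 _ (by cases a <;> cases b <;> simp [tbl]) _ _)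
  rw [← hσ₂, ← hYdef] at ht
  have k2 : ∀ k, (k = 1 ∨ k = 2 ∨ k = 3) → σ₂.arr k = σ₁.arr k := by
    intro k hk
    rw [hσ₂, Code.run_keepsArr p (by revert k; decide)]
  have k3 : σ₃.arr = σ₂.arr := startCode_arr p σ₂
  have hYinj : Set.InjOn Y (Set.Iio n) := by
    intro u hu v hv huv
    obtain ⟨i, rfl⟩ := exists_rank_eq hp.1 hu
    obtain ⟨j, rfl⟩ := exists_rank_eq hp.1 hv
    rw [(hr i).2, (hr j).2] at huv
    rw [rank_injective hp.2 huv]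
  have hoinj : Set.InjOn ord (Set.Iio n) := by
    intro u hu v hv huv
    obtain ⟨i, rfl⟩ := exists_rank_eq hp.1 hu
    obtain ⟨j, rfl⟩ := exists_rank_eq hp.1 hv
    rw [(hr i).1, (hr j).1] at huv
    rw [Fin.ext huv]
  have hbest := startCode_spec p (V := fun l a b => gain n Y (l + 1) a b l l) σ₂
    (fun l a b hl => by rw [ht a b l l hl hl, max_self])
    (fun l a b => (gain_le _ _ _ _ _ _ _).trans (by omega))
  rw [← hσ₃] at hbest
  obtain ⟨hmax, hz | ⟨l, a, b, hl, h12, h13, h14, h11⟩⟩ := hbest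
  -- With at least one point some initial state has value at least 1, so the search cannot return 0.
  · have := hmax 0 false false hn
    omega
  obtain ⟨Q, hQ, hU, hc, hmarks⟩ := pathCode_spec (Y := Y) (ord := ord) p hoinj a b hl h11 h12 h13
    h14 (fun j => by rw [k3, k2 _ (by simp), z1 _ (by simp)]) (by rw [k3, k2 _ (by simp)])
    (by rw [k3, k2 _ (by simp)]) (by rw [k3]; exact ht)
  refine ⟨Q, isMaxEmptyRCH_image hp (fun i => (hr i).2) hQ hU fun Q' hQ' hU' => ?_, fun i => ?_⟩
  · rcases Q'.eq_empty_or_nonempty with rfl | hne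
    · simp
    obtain ⟨l', hl', a', b', h⟩ := hU'.exists_card_le hYinj hQ' hne
    have h' : gain n Y (l' + 1) a' b' l' l' + 1 ≤ σ₃.var 11 := hmax l' a' b' hl'
    have h'' : σ₃.var 11 = gain n Y (l + 1) a b l l + 1 := h11
    omega
  · have := hmarks _ (rank_lt (fun i => (p i).1) i)
    rw [(hr i).1] at this
    change (pathCode.run p σ₃).arr 1 0 i ≠ 0 ↔ _
    rw [this]
    split_ifs with h <;> simp [h]

/-! ### Output -/

/-- The address of the entry `j` of the output array. -/
def outExpr (j : Expr) : Expr :=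
  .add (.add (.lit 64) (.mul (.add (.load (.lit 0)) (.lit 2)) (.add (.load (.lit 0)) (.lit 2)))) j

/-- The cells below 64 are copied by straight-line code, since the copying loop uses cell 1 as its
counter. Cell 0 comes last in `copyOut` because `n` is needed to compute addresses. -/
def copyCells : List ℕ → Prog
  | [] => .skip
  | c :: l => .seq (.store (.lit c) (.load (outExpr (.lit c)))) (copyCells l)

def copyLoop : Prog :=
  .while (.lt (.load (.lit 1)) (.load (.lit 0)))
    (.seq (.store (.load (.lit 1)) (.load (outExpr (.load (.lit 1)))))
      (.store (.lit 1) (.add (.load (.lit 1)) (.lit 1))))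

/-- Copies the output array to the cells `0, …, n - 1`. -/
def copyOut : Prog :=
  .seq (.store (.lit 1) (.lit 64)) <| .seq copyLoop <|
    .seq (copyCells (List.range' 1 63)) (.store (.lit 0) (.load (outExpr (.lit 0))))

theorem eval_lit {M k : ℕ} (h : k < M) (mem : ℕ → ℕ) : (Expr.lit k).eval M mem = some k := by
  simp [Expr.eval, word, h]

theorem eval_load_lit {M k : ℕ} (h : k < M) (mem : ℕ → ℕ) :
    (Expr.load (.lit k)).eval M mem = some (mem k) := by
  rw [Expr.eval, eval_lit h, Option.map_some]

section

variable {n M : ℕ} {p : Fin n → ℝ × ℝ}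

theorem eval_outExpr (hM : 200 + 8 * (n + 2) ^ 2 ≤ M) {mem : ℕ → ℕ} (h0 : mem 0 = n) {e : Expr}
    {j : ℕ} (he : e.eval M mem = some j) (hj : j < 64 ∨ j < n) :
    (outExpr e).eval M mem = some (64 + (n + 2) ^ 2 + j) := by
  have h2 : n + 2 ≤ (n + 2) ^ 2 := Nat.le_self_pow (by omega) _
  have hsq : (n + 2) * (n + 2) = (n + 2) ^ 2 := (sq _).symm
  simp [outExpr, Expr.eval, word, he, h0, hsq, show 64 < M by omega, show 0 < M by omega,
    show 2 < M by omega, show n + 2 < M by omega, show (n + 2) ^ 2 < M by omega,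
    show 64 + (n + 2) ^ 2 < M by omega, show 64 + (n + 2) ^ 2 + j < M by omega]

theorem exec_copyCells (hM : 200 + 8 * (n + 2) ^ 2 ≤ M) (l : List ℕ)
    (hl : ∀ c ∈ l, 1 ≤ c ∧ c < 64) (mem : ℕ → ℕ) (h0 : mem 0 = n) :
    ∃ mem', Exec p M (copyCells l) mem (16 * l.length + 1) mem' ∧
      (∀ c ∈ l, mem' c = mem (64 + (n + 2) ^ 2 + c)) ∧ ∀ x, x ∉ l → mem' x = mem x := by
  induction l generalizing mem with
  | nil => exact ⟨mem, .skip mem, by simp, by simp⟩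
  | cons c l ih =>
    have hc := hl c (by simp)
    obtain ⟨mem', he, h1, h2⟩ := ih (fun c' hc' => hl c' (by simp [hc']))
      (Function.update mem c (mem (64 + (n + 2) ^ 2 + c)))
      (by rw [Function.update_of_ne (by omega), h0])
    refine ⟨mem', ?_, fun c' hc' => ?_, fun x hx => ?_⟩
    · have hs : Exec p M (.store (.lit c) (.load (outExpr (.lit c)))) mem _ _ :=
        .store (eval_lit (show c < M by omega) mem) (v := mem (64 + (n + 2) ^ 2 + c)) (by
          rw [Expr.eval, eval_outExpr hM h0 (eval_lit (show c < M by omega) mem) (Or.inl hc.2),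
            Option.map_some])
      have ht : (Expr.lit c).cost + (Expr.load (outExpr (.lit c))).cost + 1 + (16 * l.length + 1) =
          16 * (c :: l).length + 1 := by
        simp only [Expr.cost, outExpr, List.length_cons]
        omega
      rw [← ht]
      exact hs.seq he
    · by_cases hcl : c' ∈ l
      · have := hl c' hc'
        rw [h1 c' hcl, Function.update_of_ne (by omega)]
      · obtain rfl : c' = c := by simpa [hcl] using hc'
        rw [h2 c' hcl, Function.update_self]
    · simp only [List.mem_cons, not_or] at hx
      rw [h2 x hx.2, Function.update_of_ne hx.1]

/-- The source starts at `64 + (n + 2) ^ 2`, beyond every target cell, so copying never destroys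
data still to be read. -/
theorem exec_copyLoop (hM : 200 + 8 * (n + 2) ^ 2 ≤ M) (m k : ℕ) (hk : 64 ≤ k) (hm : m = n - k)
    (mem : ℕ → ℕ) (h0 : mem 0 = n) (h1 : mem 1 = k) :
    ∃ t ≤ m * 40 + 10, ∃ mem', Exec p M copyLoop mem t mem' ∧
      (∀ x, k ≤ x → x < n → mem' x = mem (64 + (n + 2) ^ 2 + x)) ∧
      ∀ x, x ≠ 1 → (x < k ∨ n ≤ x) → mem' x = mem x := by
  have hM0 : 0 < M := by omega
  have hM1 : 1 < M := by omega
  have hsq : n + 2 ≤ (n + 2) ^ 2 := Nat.le_self_pow (by omega) _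
  induction m generalizing k mem with
  | zero =>
    refine ⟨_, ?_, mem, .while_false ?_, fun x hx hxn => by omega, fun x _ _ => rfl⟩
    · simp [Test.cost, Expr.cost]
    · rw [Test.eval, eval_load_lit hM1, eval_load_lit hM0, h0, h1]
      simp only [Option.bind_some, Option.some.injEq, decide_eq_false_iff_not]
      omega
  | succ m ih =>
    set v := mem (64 + (n + 2) ^ 2 + k) with hv
    set mem₁ := Function.update mem k v with hmem₁
    have g0 : mem₁ 0 = n := by rw [hmem₁, Function.update_of_ne (by omega), h0]
    have g1 : mem₁ 1 = k := by rw [hmem₁, Function.update_of_ne (by omega), h1]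
    obtain ⟨t, ht, mem', he, a1, a2⟩ := ih (k + 1) (by omega) (by omega)
      (Function.update mem₁ 1 (k + 1)) (by rw [Function.update_of_ne (by omega), g0])
      (Function.update_self _ _ _)
    refine ⟨_, ?_, mem', .while_true ?_ (.seq (.store (i := k) (v := v) ?_ ?_)
      (.store (i := 1) (v := k + 1) (eval_lit hM1 _) ?_)) he, fun x hx hxn => ?_,
      fun x hx hx' => ?_⟩
    · simp only [Test.cost, Expr.cost, outExpr]
      omega
    · rw [Test.eval, eval_load_lit hM1, eval_load_lit hM0, h0, h1]
      simp only [Option.bind_some, Option.some.injEq, decide_eq_true_eq]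
      omega
    · rw [eval_load_lit hM1, h1]
    · rw [Expr.eval, eval_outExpr hM h0 (eval_load_lit hM1 mem) (by rw [h1]; omega),
        Option.map_some, h1]
    · change Expr.eval M mem₁ _ = _
      rw [Expr.eval, eval_load_lit hM1, eval_lit hM1, g1]
      simp only [Option.bind_some, word]
      rw [if_pos (by omega)]
    · by_cases hxk : x = k
      · subst hxk
        rw [a2 x (by omega) (by omega), Function.update_of_ne (by omega), hmem₁,
          Function.update_self]
      · rw [a1 x (by omega) hxn, Function.update_of_ne (by omega), hmem₁,
          Function.update_of_ne (by omega)]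
    · rw [a2 x hx (by omega), Function.update_of_ne hx, hmem₁, Function.update_of_ne (by omega)]

theorem exec_copyOut (hM : 200 + 8 * (n + 2) ^ 2 ≤ M) (mem : ℕ → ℕ) (h0 : mem 0 = n) :
    ∃ t ≤ n * 40 + 1100, ∃ mem', Exec p M copyOut mem t mem' ∧
      ∀ i < n, mem' i = mem (64 + (n + 2) ^ 2 + i) := by
  have hM0 : 0 < M := by omega
  have hM1 : 1 < M := by omega
  have hM64 : 64 < M := by omega
  have hsq : n + 2 ≤ (n + 2) ^ 2 := Nat.le_self_pow (by omega) _
  obtain ⟨t, ht, mem₁, e₁, a1, a2⟩ := exec_copyLoop (p := p) hM (n - 64) 64 le_rfl rfl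
    (Function.update mem 1 64) (by rw [Function.update_of_ne (by omega), h0])
    (Function.update_self _ _ _)
  have g0 : mem₁ 0 = n := by rw [a2 0 (by omega) (by omega), Function.update_of_ne (by omega), h0]
  have hmem : ∀ c, c ∈ List.range' 1 63 ↔ 1 ≤ c ∧ c < 64 := fun c => by
    rw [List.mem_range'_1]
  obtain ⟨mem₂, e₂, b1, b2⟩ := exec_copyCells (p := p) hM (List.range' 1 63)
    (fun c hc => (hmem c).1 hc) mem₁ g0
  have g0' : mem₂ 0 = n := by rw [b2 0 (by rw [hmem]; omega), g0]
  refine ⟨_, ?_, _, .seq (.store (eval_lit hM1 mem) (eval_lit hM64 mem)) (.seq e₁ (.seq e₂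
    (.store (eval_lit hM0 mem₂) (v := mem₂ (64 + (n + 2) ^ 2 + 0)) ?_))), fun i hi => ?_⟩
  · simp only [Expr.cost, outExpr, List.length_range']
    omega
  · rw [Expr.eval, eval_outExpr hM g0' (eval_lit hM0 mem₂) (by omega), Option.map_some]
  -- The source cells survive both the loop and the straight-line copies.
  · have far : ∀ x, n ≤ x → 64 ≤ x → mem₂ x = mem x := fun x hx hx' => by
      rw [b2 x (by rw [hmem]; omega), a2 x (by omega) (by omega), Function.update_of_ne (by omega)]
    by_cases hi0 : i = 0
    · subst hi0
      rw [Function.update_self, far _ (by omega) (by omega)]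
    rw [Function.update_of_ne hi0]
    by_cases hi64 : i < 64
    · rw [b1 i (by rw [hmem]; omega), a2 _ (by omega) (by omega), Function.update_of_ne (by omega)]
    · rw [b2 i (by rw [hmem]; omega), a1 i (by omega) hi, Function.update_of_ne (by omega)]

end

theorem adr_output (n i : ℕ) : adr n (1 : Fin 8) 0 i = 64 + (n + 2) ^ 2 + i := by
  simp [adr, sq, add_assoc]

theorem represents_initMem (n : ℕ) : Represents n zeroStore (initMem n) where
  size := by simp [initMem]
  var x := by simp [initMem, zeroStore]
  arr k i j _ _ := by simp [initMem, zeroStore, adr]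
  var_le x := Nat.zero_le _
  arr_le k i j := Nat.zero_le _

end RectHull

/-! ### The space and time bounds for the assembled program. -/

theorem mainTheorem2 :
    ∃ (prog : RectHull.Prog) (C : ℕ), ∀ (n : ℕ) (p : Fin n → ℝ × ℝ),
      RectHull.GeneralPosition p →
        ∃ (t : ℕ) (mem : ℕ → ℕ),
          RectHull.Exec p (C * (n ^ 2 + 1)) prog (RectHull.initMem n) t mem ∧
          t ≤ C * (n ^ 3 + 1) ∧
          RectHull.IsMaxEmptyRCH (Set.range p) (RectHull.outputSet p mem) := by
  open RectHull in
  refine ⟨.seq mainCode.compile copyOut, 8 * mainCode.coeff + 2000, fun n p hp => ?_⟩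
  obtain ⟨κ, hκ⟩ : ∃ κ, κ = mainCode.coeff := ⟨_, rfl⟩
  rw [← hκ]
  -- Eight arrays of side `n + 2` behind 64 cells; the surplus keeps valid the reads past the output
  -- row that occur when all of cells 1 to 63 are copied for small `n`.
  have hM : 200 + 8 * (n + 2) ^ 2 ≤ (8 * κ + 2000) * (n ^ 2 + 1) := by
    nlinarith [sq_nonneg ((n : ℤ) - 1)]
  obtain ⟨t, ht, mem, he, hrep⟩ := mainCode.exec_compile p (le_trans (by omega) hM) (by decide)
    zeroStore (initMem n) (represents_initMem n)
  obtain ⟨t', ht', mem', he', hout⟩ := exec_copyOut (p := p) hM mem hrep.size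
  obtain ⟨Q, hQ, hmarks⟩ := mainCode_spec hp
  refine ⟨t + t', mem', .seq he he', ?_, ?_⟩
  · have h1 := ht.trans (mainCode.time_le n)
    rw [show mainCode.depth = 3 by decide, ← hκ] at h1
    -- The source of the factor 8 in the constant.
    have h2 : (n + 1) ^ 3 ≤ 8 * (n ^ 3 + 1) := by
      rcases Nat.eq_zero_or_pos n with rfl | hn
      · norm_num
      · calc (n + 1) ^ 3 ≤ (2 * n) ^ 3 := Nat.pow_le_pow_left (by omega) 3
          _ = 8 * n ^ 3 := by ring
          _ ≤ _ := by omega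
    have h3 : n ≤ n ^ 3 := Nat.le_self_pow (by omega) n
    nlinarith [Nat.mul_le_mul_left κ h2]
  · convert hQ using 1
    ext z
    constructor
    · rintro ⟨i, hi, rfl⟩
      refine ⟨i, (hmarks i).1 ?_, rfl⟩
      rwa [← hrep.arr 1 0 i (by omega) (by omega), adr_output, ← hout i i.2]
    · rintro ⟨i, hi, rfl⟩
      refine ⟨i, ?_, rfl⟩
      have := (hmarks i).2 hi
      rwa [← hrep.arr 1 0 i (by omega) (by omega), adr_output, ← hout i i.2] at this
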